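/- **Theorem (Preservation of $\mathsf F_{<:M}$).** The calculus $\mathsf F_{<:M}$ (System $\mathsf F_{<:}$ with type qualifiers, qualifier polymorphism and mutable references) is defined as follows; terms and types are taken up to renaming of bound variables, and every type, bound and qualifier that occurs is well scoped. *Syntax.* Qualifiers $P,Q,R ::= \top \mid \bot \mid Y \mid Q\wedge R \mid Q\vee R$, where $\top$ is `readonly`, $\bot$ is `mutable`, and $Y$ is a qualifier variable. Qualified types $T,U ::= \{Q\}\,S$; simple types $S,B ::= \top \mid X \mid T\to U \mid \forall(X<:B).T \mid \forall(Y<:Q).T \mid \mathrm{box}\,T$. Terms $s,t ::= x \mid \lambda_P(x).t \mid \Lambda_P(X<:B).t \mid \Lambda_P(Y<:Q).t \mid s\,t \mid s[S] \mid s\{\!\{Q\}\!\} \mid \mathrm{upqual}\,P\,s \mid \mathrm{assert}\,P\,s \mid \mathrm{box}_P\,s \mid l_P \mid \mathrm{unbox}\,s \mid \mathrm{setbox}\,s\,t$, with $l$ a store location. The values $v,w$ are the three abstractions and $l_P$; each is tagged with its $P$. Contexts $\Gamma$ are finite lists of bindings $x:T$, $X<:B$, $Y<:Q$, each in the scope of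 the earlier ones. A store $\sigma$ is a finite partial map from locations to values. A store environment $\Sigma$ is a partial map from locations to qualified types in the scope of $\Gamma$. *Reduction.* $\mathrm{eval}(Q)\in\{\bot\sqsubseteq\top\}$ is the value of a variable-free qualifier in the two-point lattice, and is undefined if $Q$ contains a variable. Reduction is call-by-value, left to right, in all argument positions of $s\,t$, $s[S]$, $s\{\!\{Q\}\!\}$, $\mathrm{upqual}$, $\mathrm{assert}$, $\mathrm{box}$, $\mathrm{unbox}$, $\mathrm{setbox}$, and is generated by - $\langle(\lambda_P(x).t)\,v,\sigma\rangle\longrightarrow\langle t[x:=v],\sigma\rangle$; $\langle(\Lambda_P(X<:B).t)[S],\sigma\rangle\longrightarrow\langle t[X:=S],\sigma\rangle$; $\langle(\Lambda_P(Y<:R).t)\{\!\{Q\}\!\},\sigma\rangle\longrightarrow\langle t[Y:=Q],\sigma\rangle$; - if $v$ is tagged $Q$ and $\mathrm{eval}(Q)\sqsubseteq\mathrm{eval}(P)$ (both defined): $\langle\mathrm{upqual}\,P\,v,\sigma\rangle\longrightarrow\langle v\text{ retagged with }P,\sigma\rangle$ and $\langle\mathrm{assert}\,P\,v,\sigma\rangle\longrightarrow\langle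 v,\sigma\rangle$; - if $l\notin\mathrm{dom}\,\sigma$: $\langle\mathrm{box}_P\,v,\sigma\rangle\longrightarrow\langle l_P,\sigma[l\mapsto v]\rangle$; - if $\sigma(l)=v$ is tagged $Q$: $\langle\mathrm{unbox}\,l_P,\sigma\rangle\longrightarrow\langle v\text{ retagged with }P\vee Q,\sigma\rangle$; - if $\mathrm{eval}(P)=\bot$ and $\sigma(l)=w$: $\langle\mathrm{setbox}\,l_P\,v,\sigma\rangle\longrightarrow\langle w,\sigma[l\mapsto v]\rangle$. *Subqualification* $\Gamma\vdash Q<:R$ is generated by $Q<:\top$; $\bot<:Q$; $Y<:Y$; $Y<:R$ if $(Y<:Q)\in\Gamma$ and $Q<:R$; $Q_1\wedge Q_2<:R$ if $Q_1<:R$ or $Q_2<:R$; $Q<:R_1\wedge R_2$ if $Q<:R_1$ and $Q<:R_2$; $Q<:R_1\vee R_2$ if $Q<:R_1$ or $Q<:R_2$; $Q_1\vee Q_2<:R$ if $Q_1<:R$ and $Q_2<:R$. *Subtyping.* $\Gamma\vdash\{Q\}S<:\{Q'\}S'$ if $\Gamma\vdash Q<:Q'$ and $\Gamma\vdash S<:S'$.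 On simple types it is generated by $S<:\top$; $X<:X$; $X<:S$ if $(X<:B)\in\Gamma$ and $B<:S$; $(T_1\to T_2)<:(U_1\to U_2)$ if $U_1<:T_1$ and $T_2<:U_2$; $\forall(X<:B_1).T_1<:\forall(X<:B_2).T_2$ if $\Gamma\vdash B_2<:B_1$ and $\Gamma,X<:B_2\vdash T_1<:T_2$; the same rule for $\forall(Y<:Q).T$; and $\mathrm{box}\,T<:\mathrm{box}\,U$ if $T<:U$ and $U<:T$. *Typing* $\Gamma\mid\Sigma\vdash t:T$ is generated by - $x:T$ if $(x:T)\in\Gamma$; subsumption: $t:U$ if $t:T$ and $\Gamma\vdash T<:U$; - $\lambda_P(x).t:\{P\}(T\to U)$ if $\Gamma,x:T\mid\Sigma\vdash t:U$; $\Lambda_P(X<:B).t:\{P\}\forall(X<:B).T$ if $\Gamma,X<:B\mid\Sigma\vdash t:T$; $\Lambda_P(Y<:Q).t:\{P\}\forall(Y<:Q).T$ if $\Gamma,Y<:Q\mid\Sigma\vdash t:T$; - $s\,t:U$ if $s:\{Q\}(T\to U)$ and $t:T$; $s[S]:T[X:=S]$ if $s:\{Q\}\forall(X<:B).T$ and $\Gamma\vdash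 S<:B$; $s\{\!\{R\}\!\}:T[Y:=R]$ if $s:\{Q\}\forall(Y<:Q').T$ and $\Gamma\vdash R<:Q'$; - $\mathrm{assert}\,P\,s:\{Q\}S$ and $\mathrm{upqual}\,P\,s:\{P\}S$ if $s:\{Q\}S$ and $\Gamma\vdash Q<:P$; - $\mathrm{box}_P\,s:\{P\}\,\mathrm{box}\,T$ if $s:T$; $l_P:\{P\}\,\mathrm{box}\,T$ if $\Sigma(l)=T$; - $\mathrm{unbox}\,s:\{R\vee Q\}S$ if $s:\{R\}\,\mathrm{box}\,\{Q\}S$; $\mathrm{setbox}\,s\,t:T$ if $s:\{\bot\}\,\mathrm{box}\,T$ and $t:T$. The store typing $\Gamma\mid\Sigma\vdash\sigma$ means that $\mathrm{dom}\,\Sigma=\mathrm{dom}\,\sigma$ and $\Gamma\mid\Sigma\vdash\sigma(l):\Sigma(l)$ for every $l\in\mathrm{dom}\,\sigma$. *Claim.* For every context $\Gamma$: suppose $\langle s,\sigma\rangle\longrightarrow\langle t,\sigma'\rangle$. If $\Gamma\mid\Sigma\vdash\sigma$ and $\Gamma\mid\Sigma\vdash s:T$ for some type $T$, then there is an extension $\Sigma'$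 of $\Sigma$ (that is, $\Sigma'(l)=\Sigma(l)$ for every $l\in\mathrm{dom}\,\Sigma$) such that $\Gamma\mid\Sigma'\vdash\sigma'$ and $\Gamma\mid\Sigma'\vdash t:T$. -/

import Mathlib

/-!
Syntax, subtyping, typing and reduction of the calculus F<:M.  Syntax is intrinsically scoped with
de Bruijn indices, in three separate name spaces: `m` term variables, `n` type variables and
`k` qualifier variables.  Every type, bound and context is therefore well formed by construction.
-/

namespace FM

/-- Qualifier expressions: `top` is `readonly`, `bot` is `mutable`. -/
inductive Qual : ℕ → Type
  | top {k : ℕ} : Qual k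
  | bot {k : ℕ} : Qual k
  | var {k : ℕ} (Y : Fin k) : Qual k
  | meet {k : ℕ} (Q R : Qual k) : Qual k
  | join {k : ℕ} (Q R : Qual k) : Qual k

/-- Simple types.  The qualified types `{Q} S` that occur inside a simple type are stored as two
consecutive arguments, a qualifier and a simple type. -/
inductive STy : ℕ → ℕ → Type
  | top {n k : ℕ} : STy n k
  | var {n k : ℕ} (X : Fin n) : STy n k
  /-- `{Q₁} S₁ → {Q₂} S₂` -/
  | arr {n k : ℕ} (Q₁ : Qual k) (S₁ : STy n k) (Q₂ : Qual k) (S₂ : STy n k) : STy n k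
  /-- `∀ (X <: B). {Q} S` -/
  | all {n k : ℕ} (B : STy n k) (Q : Qual k) (S : STy (n + 1) k) : STy n k
  /-- `∀ (Y <: B). {Q} S` -/
  | qall {n k : ℕ} (B : Qual k) (Q : Qual (k + 1)) (S : STy n (k + 1)) : STy n k
  /-- `box ({Q} S)` -/
  | box {n k : ℕ} (Q : Qual k) (S : STy n k) : STy n k

/-- Qualified types `{Q} S`. -/
@[ext]
structure QTy (n k : ℕ) where
  qual : Qual k
  ty : STy n k

/-- The function type `T → U` between qualified types. -/
abbrev STy.arrow {n k : ℕ} (T U : QTy n k) : STy n k := .arr T.qual T.ty U.qual U.ty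

/-- The bounded type quantification `∀ (X <: B). T`. -/
abbrev STy.allT {n k : ℕ} (B : STy n k) (T : QTy (n + 1) k) : STy n k := .all B T.qual T.ty

/-- The bounded qualifier quantification `∀ (Y <: B). T`. -/
abbrev STy.allQ {n k : ℕ} (B : Qual k) (T : QTy n (k + 1)) : STy n k := .qall B T.qual T.ty

/-- The reference type `box T`. -/
abbrev STy.ref {n k : ℕ} (T : QTy n k) : STy n k := .box T.qual T.ty

/-- Terms.  `P` is always the qualifier tag of the value that is introduced. -/
inductive Tm : ℕ → ℕ → ℕ → Type
  | var {m n k : ℕ} (x : Fin m) : Tm m n k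
  /-- `λ_P (x). t`; the argument type is not annotated -/
  | lam {m n k : ℕ} (P : Qual k) (t : Tm (m + 1) n k) : Tm m n k
  /-- `Λ_P (X <: B). t` -/
  | tlam {m n k : ℕ} (P : Qual k) (B : STy n k) (t : Tm m (n + 1) k) : Tm m n k
  /-- `Λ_P (Y <: B). t` -/
  | qlam {m n k : ℕ} (P : Qual k) (B : Qual k) (t : Tm m n (k + 1)) : Tm m n k
  | app {m n k : ℕ} (s t : Tm m n k) : Tm m n k
  | tapp {m n k : ℕ} (s : Tm m n k) (S : STy n k) : Tm m n k
  | qapp {m n k : ℕ} (s : Tm m n k) (Q : Qual k) : Tm m n k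
  | upqual {m n k : ℕ} (P : Qual k) (s : Tm m n k) : Tm m n k
  | assert {m n k : ℕ} (P : Qual k) (s : Tm m n k) : Tm m n k
  /-- creation of a reference cell with tag `P` -/
  | box {m n k : ℕ} (P : Qual k) (s : Tm m n k) : Tm m n k
  /-- a store location, used at tag `P` (a runtime form) -/
  | loc {m n k : ℕ} (P : Qual k) (l : ℕ) : Tm m n k
  | unbox {m n k : ℕ} (s : Tm m n k) : Tm m n k
  | setbox {m n k : ℕ} (s t : Tm m n k) : Tm m n k

/-! ### Renaming -/

/-- Extend a renaming under a binder. -/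
def up {a b : ℕ} (ρ : Fin a → Fin b) : Fin (a + 1) → Fin (b + 1) :=
  Fin.cases 0 (fun i => (ρ i).succ)

def Qual.rename {k k' : ℕ} (ρ : Fin k → Fin k') : Qual k → Qual k'
  | .top => .top
  | .bot => .bot
  | .var Y => .var (ρ Y)
  | .meet Q R => .meet (Q.rename ρ) (R.rename ρ)
  | .join Q R => .join (Q.rename ρ) (R.rename ρ)

def STy.rename {n k n' k' : ℕ} (ρt : Fin n → Fin n') (ρq : Fin k → Fin k') :
    STy n k → STy n' k'
  | .top => .top
  | .var X => .var (ρt X)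
  | .arr Q₁ S₁ Q₂ S₂ =>
      .arr (Q₁.rename ρq) (S₁.rename ρt ρq) (Q₂.rename ρq) (S₂.rename ρt ρq)
  | .all B Q S => .all (B.rename ρt ρq) (Q.rename ρq) (S.rename (up ρt) ρq)
  | .qall B Q S => .qall (B.rename ρq) (Q.rename (up ρq)) (S.rename ρt (up ρq))
  | .box Q S => .box (Q.rename ρq) (S.rename ρt ρq)

def QTy.rename {n k n' k' : ℕ} (ρt : Fin n → Fin n') (ρq : Fin k → Fin k') (T : QTy n k) :
    QTy n' k' :=
  ⟨T.qual.rename ρq, T.ty.rename ρt ρq⟩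

def Tm.rename {m n k m' n' k' : ℕ} (ρ : Fin m → Fin m') (ρt : Fin n → Fin n')
    (ρq : Fin k → Fin k') : Tm m n k → Tm m' n' k'
  | .var x => .var (ρ x)
  | .lam P t => .lam (P.rename ρq) (t.rename (up ρ) ρt ρq)
  | .tlam P B t => .tlam (P.rename ρq) (B.rename ρt ρq) (t.rename ρ (up ρt) ρq)
  | .qlam P B t => .qlam (P.rename ρq) (B.rename ρq) (t.rename ρ ρt (up ρq))
  | .app s t => .app (s.rename ρ ρt ρq) (t.rename ρ ρt ρq)
  | .tapp s S => .tapp (s.rename ρ ρt ρq) (S.rename ρt ρq)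
  | .qapp s Q => .qapp (s.rename ρ ρt ρq) (Q.rename ρq)
  | .upqual P s => .upqual (P.rename ρq) (s.rename ρ ρt ρq)
  | .assert P s => .assert (P.rename ρq) (s.rename ρ ρt ρq)
  | .box P s => .box (P.rename ρq) (s.rename ρ ρt ρq)
  | .loc P l => .loc (P.rename ρq) l
  | .unbox s => .unbox (s.rename ρ ρt ρq)
  | .setbox s t => .setbox (s.rename ρ ρt ρq) (t.rename ρ ρt ρq)

/-! ### Weakening by one fresh variable of a given sort -/

def Qual.wkQ {k : ℕ} (Q : Qual k) : Qual (k + 1) := Q.rename Fin.succ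

def STy.wkT {n k : ℕ} (S : STy n k) : STy (n + 1) k := S.rename Fin.succ id
def STy.wkQ {n k : ℕ} (S : STy n k) : STy n (k + 1) := S.rename id Fin.succ

def QTy.wkT {n k : ℕ} (T : QTy n k) : QTy (n + 1) k := T.rename Fin.succ id
def QTy.wkQ {n k : ℕ} (T : QTy n k) : QTy n (k + 1) := T.rename id Fin.succ

def Tm.wkV {m n k : ℕ} (t : Tm m n k) : Tm (m + 1) n k := t.rename Fin.succ id id
def Tm.wkT {m n k : ℕ} (t : Tm m n k) : Tm m (n + 1) k := t.rename id Fin.succ id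
def Tm.wkQ {m n k : ℕ} (t : Tm m n k) : Tm m n (k + 1) := t.rename id id Fin.succ

/-! ### Simultaneous capture-avoiding substitution -/

/-- Extend a qualifier substitution under a qualifier binder. -/
def upQ {k k' : ℕ} (τ : Fin k → Qual k') : Fin (k + 1) → Qual (k' + 1) :=
  Fin.cases (.var 0) (fun i => (τ i).wkQ)

/-- Extend a type substitution under a type binder. -/
def upT {n n' k' : ℕ} (τ : Fin n → STy n' k') : Fin (n + 1) → STy (n' + 1) k' :=
  Fin.cases (.var 0) (fun i => (τ i).wkT)

/-- Extend a term substitution under a term binder. -/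
def upV {m m' n' k' : ℕ} (τ : Fin m → Tm m' n' k') : Fin (m + 1) → Tm (m' + 1) n' k' :=
  Fin.cases (.var 0) (fun i => (τ i).wkV)

def Qual.subst {k k' : ℕ} (τ : Fin k → Qual k') : Qual k → Qual k'
  | .top => .top
  | .bot => .bot
  | .var Y => τ Y
  | .meet Q R => .meet (Q.subst τ) (R.subst τ)
  | .join Q R => .join (Q.subst τ) (R.subst τ)

def STy.subst {n k n' k' : ℕ} (τt : Fin n → STy n' k') (τq : Fin k → Qual k') :
    STy n k → STy n' k'
  | .top => .top
  | .var X => τt X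
  | .arr Q₁ S₁ Q₂ S₂ =>
      .arr (Q₁.subst τq) (S₁.subst τt τq) (Q₂.subst τq) (S₂.subst τt τq)
  | .all B Q S => .all (B.subst τt τq) (Q.subst τq) (S.subst (upT τt) τq)
  | .qall B Q S =>
      .qall (B.subst τq) (Q.subst (upQ τq)) (S.subst (fun i => (τt i).wkQ) (upQ τq))
  | .box Q S => .box (Q.subst τq) (S.subst τt τq)

def QTy.subst {n k n' k' : ℕ} (τt : Fin n → STy n' k') (τq : Fin k → Qual k') (T : QTy n k) :
    QTy n' k' :=
  ⟨T.qual.subst τq, T.ty.subst τt τq⟩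

def Tm.subst {m n k m' n' k' : ℕ} (τ : Fin m → Tm m' n' k') (τt : Fin n → STy n' k')
    (τq : Fin k → Qual k') : Tm m n k → Tm m' n' k'
  | .var x => τ x
  | .lam P t => .lam (P.subst τq) (t.subst (upV τ) τt τq)
  | .tlam P B t =>
      .tlam (P.subst τq) (B.subst τt τq) (t.subst (fun i => (τ i).wkT) (upT τt) τq)
  | .qlam P B t =>
      .qlam (P.subst τq) (B.subst τq)
        (t.subst (fun i => (τ i).wkQ) (fun i => (τt i).wkQ) (upQ τq))
  | .app s t => .app (s.subst τ τt τq) (t.subst τ τt τq)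
  | .tapp s S => .tapp (s.subst τ τt τq) (S.subst τt τq)
  | .qapp s Q => .qapp (s.subst τ τt τq) (Q.subst τq)
  | .upqual P s => .upqual (P.subst τq) (s.subst τ τt τq)
  | .assert P s => .assert (P.subst τq) (s.subst τ τt τq)
  | .box P s => .box (P.subst τq) (s.subst τ τt τq)
  | .loc P l => .loc (P.subst τq) l
  | .unbox s => .unbox (s.subst τ τt τq)
  | .setbox s t => .setbox (s.subst τ τt τq) (t.subst τ τt τq)

/-! ### Substitution for the most recently bound variable -/

/-- `T[X := S]` -/
def QTy.instT {n k : ℕ} (T : QTy (n + 1) k) (S : STy n k) : QTy n k :=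
  T.subst (Fin.cases S STy.var) Qual.var

/-- `T[Y := Q]` -/
def QTy.instQ {n k : ℕ} (T : QTy n (k + 1)) (Q : Qual k) : QTy n k :=
  T.subst STy.var (Fin.cases Q Qual.var)

/-- `t[x := s]` -/
def Tm.instV {m n k : ℕ} (t : Tm (m + 1) n k) (s : Tm m n k) : Tm m n k :=
  t.subst (Fin.cases s Tm.var) STy.var Qual.var

/-- `t[X := S]` -/
def Tm.instT {m n k : ℕ} (t : Tm m (n + 1) k) (S : STy n k) : Tm m n k :=
  t.subst Tm.var (Fin.cases S STy.var) Qual.var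

/-- `t[Y := Q]` -/
def Tm.instQ {m n k : ℕ} (t : Tm m n (k + 1)) (Q : Qual k) : Tm m n k :=
  t.subst Tm.var STy.var (Fin.cases Q Qual.var)

/-! ### Values, tags and evaluation of qualifier expressions -/

inductive IsValue {m n k : ℕ} : Tm m n k → Prop
  | lam (P : Qual k) (t : Tm (m + 1) n k) : IsValue (.lam P t)
  | tlam (P : Qual k) (B : STy n k) (t : Tm m (n + 1) k) : IsValue (.tlam P B t)
  | qlam (P : Qual k) (B : Qual k) (t : Tm m n (k + 1)) : IsValue (.qlam P B t)
  | loc (P : Qual k) (l : ℕ) : IsValue (.loc P l)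

/-- `HasTag v Q`: the value `v` is tagged with `Q`. -/
inductive HasTag {m n k : ℕ} : Tm m n k → Qual k → Prop
  | lam (P : Qual k) (t : Tm (m + 1) n k) : HasTag (.lam P t) P
  | tlam (P : Qual k) (B : STy n k) (t : Tm m (n + 1) k) : HasTag (.tlam P B t) P
  | qlam (P : Qual k) (B : Qual k) (t : Tm m n (k + 1)) : HasTag (.qlam P B t) P
  | loc (P : Qual k) (l : ℕ) : HasTag (.loc P l) P

/-- Replace the tag of a value by `P` (only ever applied to values). -/
def Tm.retag {m n k : ℕ} (P : Qual k) : Tm m n k → Tm m n k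
  | .lam _ t => .lam P t
  | .tlam _ B t => .tlam P B t
  | .qlam _ B t => .qlam P B t
  | .loc _ l => .loc P l
  | t => t

/-- The concrete qualifier that a qualifier expression denotes, in the two-point lattice
`Bool` (`⊥ = false` is `mutable`, `⊤ = true` is `readonly`); undefined if it contains variables. -/
def Qual.eval {k : ℕ} : Qual k → Option Bool
  | .top => some ⊤
  | .bot => some ⊥
  | .var _ => none
  | .meet Q R => Q.eval.bind fun a => R.eval.map fun b => a ⊓ b
  | .join Q R => Q.eval.bind fun a => R.eval.map fun b => a ⊔ b

/-! ### Stores and reduction -/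

abbrev Val (m n k : ℕ) : Type := {v : Tm m n k // IsValue v}

/-- A store is a finite partial map from locations to values. -/
abbrev Store (m n k : ℕ) : Type := Finmap (fun _ : ℕ => Val m n k)

/-- Call-by-value reduction `⟨s, σ⟩ ⟶ ⟨t, σ'⟩`. -/
inductive Step {m n k : ℕ} : Tm m n k → Store m n k → Tm m n k → Store m n k → Prop
  | beta_v {P : Qual k} {t : Tm (m + 1) n k} {v : Tm m n k} {σ : Store m n k} :
      IsValue v → Step (.app (.lam P t) v) σ (t.instV v) σ
  | beta_T {P : Qual k} {B : STy n k} {t : Tm m (n + 1) k} {S : STy n k} {σ : Store m n k} :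
      Step (.tapp (.tlam P B t) S) σ (t.instT S) σ
  | beta_Q {P : Qual k} {B : Qual k} {t : Tm m n (k + 1)} {Q : Qual k} {σ : Store m n k} :
      Step (.qapp (.qlam P B t) Q) σ (t.instQ Q) σ
  | upqual {P Q : Qual k} {v : Tm m n k} {a b : Bool} {σ : Store m n k} :
      IsValue v → HasTag v Q → Q.eval = some a → P.eval = some b → a ≤ b →
      Step (.upqual P v) σ (v.retag P) σ
  | assert {P Q : Qual k} {v : Tm m n k} {a b : Bool} {σ : Store m n k} :
      IsValue v → HasTag v Q → Q.eval = some a → P.eval = some b → a ≤ b →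
      Step (.assert P v) σ v σ
  /-- allocation at any fresh location -/
  | ref {P : Qual k} {v : Val m n k} {l : ℕ} {σ : Store m n k} :
      l ∉ σ → Step (.box P v.1) σ (.loc P l) (σ.insert l v)
  /-- the value read is retagged with the join of its own tag and the tag of the reference -/
  | deref {P Q : Qual k} {v : Val m n k} {l : ℕ} {σ : Store m n k} :
      σ.lookup l = some v → HasTag v.1 Q →
      Step (.unbox (.loc P l)) σ (v.1.retag (.join P Q)) σ
  /-- writing needs a reference whose tag evaluates to `mutable`, and returns the old value -/
  | update {P : Qual k} {v w : Val m n k} {l : ℕ} {σ : Store m n k} :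
      P.eval = some ⊥ → σ.lookup l = some w →
      Step (.setbox (.loc P l) v.1) σ w.1 (σ.insert l v)
  | app_left {s s' t : Tm m n k} {σ σ' : Store m n k} :
      Step s σ s' σ' → Step (.app s t) σ (.app s' t) σ'
  | app_right {v t t' : Tm m n k} {σ σ' : Store m n k} :
      IsValue v → Step t σ t' σ' → Step (.app v t) σ (.app v t') σ'
  | tapp_fun {s s' : Tm m n k} {S : STy n k} {σ σ' : Store m n k} :
      Step s σ s' σ' → Step (.tapp s S) σ (.tapp s' S) σ'
  | qapp_fun {s s' : Tm m n k} {Q : Qual k} {σ σ' : Store m n k} :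
      Step s σ s' σ' → Step (.qapp s Q) σ (.qapp s' Q) σ'
  | upqual_arg {P : Qual k} {s s' : Tm m n k} {σ σ' : Store m n k} :
      Step s σ s' σ' → Step (.upqual P s) σ (.upqual P s') σ'
  | assert_arg {P : Qual k} {s s' : Tm m n k} {σ σ' : Store m n k} :
      Step s σ s' σ' → Step (.assert P s) σ (.assert P s') σ'
  | box_arg {P : Qual k} {s s' : Tm m n k} {σ σ' : Store m n k} :
      Step s σ s' σ' → Step (.box P s) σ (.box P s') σ'
  | unbox_arg {s s' : Tm m n k} {σ σ' : Store m n k} :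
      Step s σ s' σ' → Step (.unbox s) σ (.unbox s') σ'
  | setbox_left {s s' t : Tm m n k} {σ σ' : Store m n k} :
      Step s σ s' σ' → Step (.setbox s t) σ (.setbox s' t) σ'
  | setbox_right {v t t' : Tm m n k} {σ σ' : Store m n k} :
      IsValue v → Step t σ t' σ' → Step (.setbox v t) σ (.setbox v t') σ'

/-! ### Contexts -/

/-- Typing contexts `Γ`: telescopes of bindings `x : T`, `X <: S` and `Y <: Q`. -/
inductive Ctx : ℕ → ℕ → ℕ → Type
  | nil : Ctx 0 0 0
  | consV {m n k : ℕ} (Γ : Ctx m n k) (T : QTy n k) : Ctx (m + 1) n k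
  | consT {m n k : ℕ} (Γ : Ctx m n k) (B : STy n k) : Ctx m (n + 1) k
  | consQ {m n k : ℕ} (Γ : Ctx m n k) (B : Qual k) : Ctx m n (k + 1)

/-- The type of a term variable, as a type over the whole context. -/
def Ctx.typeOf {m n k : ℕ} : Ctx m n k → Fin m → QTy n k
  | .nil => fun x => x.elim0
  | .consV Γ T => Fin.cases T Γ.typeOf
  | .consT Γ _ => fun x => (Γ.typeOf x).wkT
  | .consQ Γ _ => fun x => (Γ.typeOf x).wkQ

/-- The bound of a type variable, as a simple type over the whole context. -/
def Ctx.boundT {m n k : ℕ} : Ctx m n k → Fin n → STy n k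
  | .nil => fun X => X.elim0
  | .consV Γ _ => Γ.boundT
  | .consT Γ B => Fin.cases B.wkT (fun X => (Γ.boundT X).wkT)
  | .consQ Γ _ => fun X => (Γ.boundT X).wkQ

/-- The bound of a qualifier variable, as a qualifier over the whole context. -/
def Ctx.boundQ {m n k : ℕ} : Ctx m n k → Fin k → Qual k
  | .nil => fun Y => Y.elim0
  | .consV Γ _ => Γ.boundQ
  | .consT Γ _ => Γ.boundQ
  | .consQ Γ B => Fin.cases B.wkQ (fun Y => (Γ.boundQ Y).wkQ)

/-! ### Subqualification and subtyping -/

/-- Subqualification `Γ ⊢ Q <: R`. -/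
inductive SubQual {m n k : ℕ} (Γ : Ctx m n k) : Qual k → Qual k → Prop
  | top {Q : Qual k} : SubQual Γ Q .top
  | bot {Q : Qual k} : SubQual Γ .bot Q
  | refl_var {Y : Fin k} : SubQual Γ (.var Y) (.var Y)
  | var {Y : Fin k} {Q : Qual k} : SubQual Γ (Γ.boundQ Y) Q → SubQual Γ (.var Y) Q
  | meet_elim_1 {Q₁ Q₂ R : Qual k} : SubQual Γ Q₁ R → SubQual Γ (.meet Q₁ Q₂) R
  | meet_elim_2 {Q₁ Q₂ R : Qual k} : SubQual Γ Q₂ R → SubQual Γ (.meet Q₁ Q₂) R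
  | meet_intro {Q R₁ R₂ : Qual k} :
      SubQual Γ Q R₁ → SubQual Γ Q R₂ → SubQual Γ Q (.meet R₁ R₂)
  | join_intro_1 {Q R₁ R₂ : Qual k} : SubQual Γ Q R₁ → SubQual Γ Q (.join R₁ R₂)
  | join_intro_2 {Q R₁ R₂ : Qual k} : SubQual Γ Q R₂ → SubQual Γ Q (.join R₁ R₂)
  | join_elim {Q₁ Q₂ R : Qual k} :
      SubQual Γ Q₁ R → SubQual Γ Q₂ R → SubQual Γ (.join Q₁ Q₂) R

/-- Subtyping `Γ ⊢ S <: S'` of simple types, with the full rule for bounded quantifiers.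
Premises on qualified types `{Q} S <: {Q'} S'` are spelled out as `Q <: Q'` and `S <: S'`. -/
inductive SubS : {m n k : ℕ} → Ctx m n k → STy n k → STy n k → Prop
  | top {m n k : ℕ} {Γ : Ctx m n k} {S : STy n k} : SubS Γ S .top
  | refl_var {m n k : ℕ} {Γ : Ctx m n k} {X : Fin n} : SubS Γ (.var X) (.var X)
  | var {m n k : ℕ} {Γ : Ctx m n k} {X : Fin n} {S : STy n k} :
      SubS Γ (Γ.boundT X) S → SubS Γ (.var X) S
  | arr {m n k : ℕ} {Γ : Ctx m n k} {Q₁ Q₂ R₁ R₂ : Qual k} {S₁ S₂ U₁ U₂ : STy n k} :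
      SubQual Γ R₁ Q₁ → SubS Γ U₁ S₁ → SubQual Γ Q₂ R₂ → SubS Γ S₂ U₂ →
      SubS Γ (.arr Q₁ S₁ Q₂ S₂) (.arr R₁ U₁ R₂ U₂)
  | all {m n k : ℕ} {Γ : Ctx m n k} {B₁ B₂ : STy n k} {Q₁ Q₂ : Qual k}
      {S₁ S₂ : STy (n + 1) k} :
      SubS Γ B₂ B₁ → SubQual (Γ.consT B₂) Q₁ Q₂ → SubS (Γ.consT B₂) S₁ S₂ →
      SubS Γ (.all B₁ Q₁ S₁) (.all B₂ Q₂ S₂)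
  | qall {m n k : ℕ} {Γ : Ctx m n k} {B₁ B₂ : Qual k} {Q₁ Q₂ : Qual (k + 1)}
      {S₁ S₂ : STy n (k + 1)} :
      SubQual Γ B₂ B₁ → SubQual (Γ.consQ B₂) Q₁ Q₂ → SubS (Γ.consQ B₂) S₁ S₂ →
      SubS Γ (.qall B₁ Q₁ S₁) (.qall B₂ Q₂ S₂)
  /-- references are invariant -/
  | box {m n k : ℕ} {Γ : Ctx m n k} {Q₁ Q₂ : Qual k} {S₁ S₂ : STy n k} :
      SubQual Γ Q₁ Q₂ → SubQual Γ Q₂ Q₁ → SubS Γ S₁ S₂ → SubS Γ S₂ S₁ →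
      SubS Γ (.box Q₁ S₁) (.box Q₂ S₂)

/-- Subtyping of qualified types: `{Q} S <: {Q'} S'` iff `Q <: Q'` and `S <: S'`. -/
def SubT {m n k : ℕ} (Γ : Ctx m n k) (T U : QTy n k) : Prop :=
  SubQual Γ T.qual U.qual ∧ SubS Γ T.ty U.ty

/-! ### Store environments and typing -/

/-- Store environments `Σ`: partial maps from locations to qualified types in the scope of `Γ`. -/
def StoreEnv (n k : ℕ) : Type := ℕ → Option (QTy n k)

def StoreEnv.wkT {n k : ℕ} (E : StoreEnv n k) : StoreEnv (n + 1) k := fun l => (E l).map QTy.wkT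
def StoreEnv.wkQ {n k : ℕ} (E : StoreEnv n k) : StoreEnv n (k + 1) := fun l => (E l).map QTy.wkQ

/-- `E'.Extends E`: `E'` agrees with `E` on the domain of `E`. -/
def StoreEnv.Extends {n k : ℕ} (E' E : StoreEnv n k) : Prop :=
  ∀ (l : ℕ) (T : QTy n k), E l = some T → E' l = some T

/-- Typing `Γ | Σ ⊢ t : T`. -/
inductive HasType : {m n k : ℕ} → Ctx m n k → StoreEnv n k → Tm m n k → QTy n k → Prop
  | var {m n k : ℕ} {Γ : Ctx m n k} {E : StoreEnv n k} {x : Fin m} :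
      HasType Γ E (.var x) (Γ.typeOf x)
  | abs {m n k : ℕ} {Γ : Ctx m n k} {E : StoreEnv n k} {P : Qual k} {T U : QTy n k}
      {t : Tm (m + 1) n k} :
      HasType (Γ.consV T) E t U → HasType Γ E (.lam P t) ⟨P, .arrow T U⟩
  | t_abs {m n k : ℕ} {Γ : Ctx m n k} {E : StoreEnv n k} {P : Qual k} {B : STy n k}
      {T : QTy (n + 1) k} {t : Tm m (n + 1) k} :
      HasType (Γ.consT B) E.wkT t T → HasType Γ E (.tlam P B t) ⟨P, .allT B T⟩
  | q_abs {m n k : ℕ} {Γ : Ctx m n k} {E : StoreEnv n k} {P : Qual k} {B : Qual k}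
      {T : QTy n (k + 1)} {t : Tm m n (k + 1)} :
      HasType (Γ.consQ B) E.wkQ t T → HasType Γ E (.qlam P B t) ⟨P, .allQ B T⟩
  | app {m n k : ℕ} {Γ : Ctx m n k} {E : StoreEnv n k} {Q : Qual k} {T U : QTy n k}
      {s t : Tm m n k} :
      HasType Γ E s ⟨Q, .arrow T U⟩ → HasType Γ E t T → HasType Γ E (.app s t) U
  | t_app {m n k : ℕ} {Γ : Ctx m n k} {E : StoreEnv n k} {Q : Qual k} {B S : STy n k}
      {T : QTy (n + 1) k} {s : Tm m n k} :
      HasType Γ E s ⟨Q, .allT B T⟩ → SubS Γ S B → HasType Γ E (.tapp s S) (T.instT S)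
  | q_app {m n k : ℕ} {Γ : Ctx m n k} {E : StoreEnv n k} {Q B R : Qual k}
      {T : QTy n (k + 1)} {s : Tm m n k} :
      HasType Γ E s ⟨Q, .allQ B T⟩ → SubQual Γ R B → HasType Γ E (.qapp s R) (T.instQ R)
  | sub {m n k : ℕ} {Γ : Ctx m n k} {E : StoreEnv n k} {T U : QTy n k} {s : Tm m n k} :
      HasType Γ E s T → SubT Γ T U → HasType Γ E s U
  | typ_assert {m n k : ℕ} {Γ : Ctx m n k} {E : StoreEnv n k} {P Q : Qual k} {S : STy n k}
      {s : Tm m n k} :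
      HasType Γ E s ⟨Q, S⟩ → SubQual Γ Q P → HasType Γ E (.assert P s) ⟨Q, S⟩
  | typ_upqual {m n k : ℕ} {Γ : Ctx m n k} {E : StoreEnv n k} {P Q : Qual k} {S : STy n k}
      {s : Tm m n k} :
      HasType Γ E s ⟨Q, S⟩ → SubQual Γ Q P → HasType Γ E (.upqual P s) ⟨P, S⟩
  | ref_intro {m n k : ℕ} {Γ : Ctx m n k} {E : StoreEnv n k} {P : Qual k} {T : QTy n k}
      {s : Tm m n k} :
      HasType Γ E s T → HasType Γ E (.box P s) ⟨P, .ref T⟩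
  | loc {m n k : ℕ} {Γ : Ctx m n k} {E : StoreEnv n k} {P : Qual k} {T : QTy n k} {l : ℕ} :
      E l = some T → HasType Γ E (.loc P l) ⟨P, .ref T⟩
  | ref_elim {m n k : ℕ} {Γ : Ctx m n k} {E : StoreEnv n k} {R Q : Qual k} {S : STy n k}
      {s : Tm m n k} :
      HasType Γ E s ⟨R, .ref ⟨Q, S⟩⟩ → HasType Γ E (.unbox s) ⟨.join R Q, S⟩
  | ref_update {m n k : ℕ} {Γ : Ctx m n k} {E : StoreEnv n k} {T : QTy n k}
      {s t : Tm m n k} :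
      HasType Γ E s ⟨.bot, .ref T⟩ → HasType Γ E t T → HasType Γ E (.setbox s t) T

/-- Store typing `Γ | Σ ⊢ σ`: `Σ` and `σ` have the same domain, and the value stored at each
location has the type that `Σ` assigns to it. -/
def StoreTyped {m n k : ℕ} (Γ : Ctx m n k) (E : StoreEnv n k) (σ : Store m n k) : Prop :=
  (∀ l : ℕ, (E l).isSome ↔ l ∈ σ) ∧
    ∀ (l : ℕ) (v : Val m n k) (T : QTy n k),
      σ.lookup l = some v → E l = some T → HasType Γ E v.1 T

end FM

namespace FM

/-! ### Composition of renamings and substitutions -/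

/-! The proof is an induction on the typing derivation of the redex. Subsumption is passed through
unchanged, congruence steps use the induction hypothesis for the active subterm and monotonicity of
typing in the store environment (`HasType.extend`) for the idle one, and what remains is one
contraction per elimination form.

Each contraction needs two things. Inversion (`HasType.lam_inv`, `HasType.tlam_inv`,
`HasType.qlam_inv`, `HasType.loc_inv`) says that the derivation for a value is its introduction rule
followed by a single subtyping step. Since that step relates two types with the same head
constructor, it can be decomposed, in any context and whatever its bounds are. `HasType.subst` then
types the contractum of a beta step. For references, invariance makes the stored type and the
visible type equivalent, so reading and overwriting are both sound; the tag of a value lies below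
the qualifier of its type, which accounts for the join produced by a read.

The substance lies in subtyping. The relations have no transitivity rule, yet inversion must
collapse chains of subsumptions and substitution must replace a variable by something below its
bound; both need transitivity. For qualifiers it is a cut elimination (`SubQual.trans`). For simple
types with the full quantifier rule, transitivity and narrowing depend on each other, and the circle
is broken by the size of the middle type (`transBelow`, `SubS.narrow_of_transBelow`). -/

theorem up_comp {a b c : ℕ} (ρ' : Fin b → Fin c) (ρ : Fin a → Fin b) :
    (fun i => up ρ' (up ρ i)) = up (fun i => ρ' (ρ i)) := by
  funext i; cases i using Fin.cases <;> rfl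

theorem Qual.rename_rename {a b c : ℕ} (ρ' : Fin b → Fin c) (ρ : Fin a → Fin b) (Q : Qual a) :
    (Q.rename ρ).rename ρ' = Q.rename (fun i => ρ' (ρ i)) := by
  induction Q <;> simp_all [Qual.rename]

theorem Qual.rename_id {k : ℕ} (Q : Qual k) : Q.rename id = Q := by
  induction Q <;> simp_all [Qual.rename]

theorem Qual.subst_rename {a b c : ℕ} (τ : Fin b → Qual c) (ρ : Fin a → Fin b) (Q : Qual a) :
    (Q.rename ρ).subst τ = Q.subst (fun i => τ (ρ i)) := by
  induction Q <;> simp_all [Qual.rename, Qual.subst]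

theorem Qual.rename_subst {a b c : ℕ} (ρ : Fin b → Fin c) (τ : Fin a → Qual b) (Q : Qual a) :
    (Q.subst τ).rename ρ = Q.subst (fun i => (τ i).rename ρ) := by
  induction Q <;> simp_all [Qual.rename, Qual.subst]

theorem Qual.subst_subst {a b c : ℕ} (τ' : Fin b → Qual c) (τ : Fin a → Qual b) (Q : Qual a) :
    (Q.subst τ).subst τ' = Q.subst (fun i => (τ i).subst τ') := by
  induction Q <;> simp_all [Qual.subst]

theorem Qual.subst_var {k : ℕ} (Q : Qual k) : Q.subst Qual.var = Q := by
  induction Q <;> simp_all [Qual.subst]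

theorem upQ_up {a b c : ℕ} (τ : Fin b → Qual c) (ρ : Fin a → Fin b) :
    (fun i => upQ τ (up ρ i)) = upQ (fun i => τ (ρ i)) := by
  funext i; cases i using Fin.cases <;> rfl

theorem rename_upQ {a b c : ℕ} (ρ : Fin b → Fin c) (τ : Fin a → Qual b) :
    (fun i => (upQ τ i).rename (up ρ)) = upQ (fun i => (τ i).rename ρ) := by
  funext i
  cases i using Fin.cases with
  | zero => rfl
  | succ i => simp [upQ, Qual.wkQ, Qual.rename_rename, up]

theorem subst_upQ {a b c : ℕ} (τ' : Fin b → Qual c) (τ : Fin a → Qual b) :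
    (fun i => (upQ τ i).subst (upQ τ')) = upQ (fun i => (τ i).subst τ') := by
  funext i
  cases i using Fin.cases with
  | zero => rfl
  | succ i => simp [upQ, Qual.wkQ, Qual.rename_subst, Qual.subst_rename]

theorem upQ_var {k : ℕ} : upQ (Qual.var : Fin k → Qual k) = Qual.var := by
  funext i; cases i using Fin.cases <;> rfl

theorem up_id {a : ℕ} : up (id : Fin a → Fin a) = id := by
  funext i; cases i using Fin.cases <;> rfl

theorem STy.rename_rename {a b c k l r : ℕ} (ρt' : Fin b → Fin c) (ρt : Fin a → Fin b)
    (ρq' : Fin l → Fin r) (ρq : Fin k → Fin l) (S : STy a k) :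
    (S.rename ρt ρq).rename ρt' ρq' =
      S.rename (fun i => ρt' (ρt i)) (fun i => ρq' (ρq i)) := by
  induction S generalizing b c l r <;>
    simp_all [STy.rename, Qual.rename_rename, up_comp]

theorem STy.rename_id {n k : ℕ} (S : STy n k) : S.rename id id = S := by
  induction S <;> simp_all [STy.rename, Qual.rename_id, up_id]

theorem upT_up {a b c k : ℕ} (τ : Fin b → STy c k) (ρ : Fin a → Fin b) :
    (fun i => upT τ (up ρ i)) = upT (fun i => τ (ρ i)) := by
  funext i; cases i using Fin.cases <;> rfl

theorem STy.subst_rename {a b c k l r : ℕ} (τt : Fin b → STy c r) (ρt : Fin a → Fin b)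
    (τq : Fin l → Qual r) (ρq : Fin k → Fin l) (S : STy a k) :
    (S.rename ρt ρq).subst τt τq = S.subst (fun i => τt (ρt i)) (fun i => τq (ρq i)) := by
  induction S generalizing b c l r <;>
    simp_all [STy.rename, STy.subst, Qual.subst_rename, upT_up, upQ_up]

theorem rename_upT {a b c k l : ℕ} (ρt : Fin b → Fin c) (ρq : Fin k → Fin l)
    (τ : Fin a → STy b k) :
    (fun i => (upT τ i).rename (up ρt) ρq) = upT (fun i => (τ i).rename ρt ρq) := by
  funext i
  cases i using Fin.cases with
  | zero => rfl
  | succ i => simp [upT, STy.wkT, STy.rename_rename, up]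

theorem STy.wkQ_rename {a b k l : ℕ} (ρt : Fin a → Fin b) (ρq : Fin k → Fin l) (S : STy a k) :
    S.wkQ.rename ρt (up ρq) = (S.rename ρt ρq).wkQ := by
  simp [STy.wkQ, STy.rename_rename, up]

theorem STy.wkT_rename {a b k l : ℕ} (ρt : Fin a → Fin b) (ρq : Fin k → Fin l) (S : STy a k) :
    S.wkT.rename (up ρt) ρq = (S.rename ρt ρq).wkT := by
  simp [STy.wkT, STy.rename_rename, up]

theorem STy.rename_subst {a b c k l r : ℕ} (ρt : Fin b → Fin c) (τt : Fin a → STy b l)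
    (ρq : Fin l → Fin r) (τq : Fin k → Qual l) (S : STy a k) :
    (S.subst τt τq).rename ρt ρq =
      S.subst (fun i => (τt i).rename ρt ρq) (fun i => (τq i).rename ρq) := by
  induction S generalizing b c l r <;>
    simp_all [STy.rename, STy.subst, Qual.rename_subst, rename_upT, rename_upQ, STy.wkQ_rename]

/-- The two mixed laws reduce both sides to one substitution. This is the binder step for
`STy.subst_subst`, and it later pushes well-typed substitutions under type binders. -/
theorem STy.wkT_subst {a b k l : ℕ} (τt : Fin a → STy b l) (τq : Fin k → Qual l) (S : STy a k) :
    S.wkT.subst (upT τt) τq = (S.subst τt τq).wkT := by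
  simp [STy.wkT, STy.rename_subst, STy.subst_rename, upT, Qual.rename_id]

theorem STy.wkQ_subst {a b k l : ℕ} (τt : Fin a → STy b l) (τq : Fin k → Qual l) (S : STy a k) :
    S.wkQ.subst (fun i => (τt i).wkQ) (upQ τq) = (S.subst τt τq).wkQ := by
  simp [STy.wkQ, STy.rename_subst, STy.subst_rename, upQ, Qual.wkQ]

theorem subst_upT {a b c k l : ℕ} (τt' : Fin b → STy c l) (τq : Fin k → Qual l)
    (τ : Fin a → STy b k) :
    (fun i => (upT τ i).subst (upT τt') τq) = upT (fun i => (τ i).subst τt' τq) := by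
  funext i
  cases i using Fin.cases with
  | zero => rfl
  | succ i => exact STy.wkT_subst _ _ _

theorem STy.subst_subst {a b c k l r : ℕ} (τt' : Fin b → STy c r) (τt : Fin a → STy b l)
    (τq' : Fin l → Qual r) (τq : Fin k → Qual l) (S : STy a k) :
    (S.subst τt τq).subst τt' τq' =
      S.subst (fun i => (τt i).subst τt' τq') (fun i => (τq i).subst τq') := by
  induction S generalizing b c l r <;>
    simp_all [STy.subst, Qual.subst_subst, subst_upT, subst_upQ, STy.wkQ_subst]

theorem upT_var {n k : ℕ} : upT (STy.var : Fin n → STy n k) = STy.var := by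
  funext i; cases i using Fin.cases <;> rfl

theorem STy.subst_var {n k : ℕ} (S : STy n k) : S.subst STy.var Qual.var = S := by
  induction S <;>
    simp_all [STy.subst, Qual.subst_var, upT_var, upQ_var, STy.wkQ, STy.rename]

theorem QTy.subst_var {n k : ℕ} (T : QTy n k) : T.subst STy.var Qual.var = T := by
  simp [QTy.subst, Qual.subst_var, STy.subst_var]

theorem QTy.rename_id {n k : ℕ} (T : QTy n k) : T.rename id id = T := by
  simp [QTy.rename, Qual.rename_id, STy.rename_id]

theorem QTy.wkT_rename {a b k l : ℕ} (ρt : Fin a → Fin b) (ρq : Fin k → Fin l) (T : QTy a k) :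
    T.wkT.rename (up ρt) ρq = (T.rename ρt ρq).wkT := by
  simp [QTy.wkT, QTy.rename, STy.rename_rename, Qual.rename_rename, up]

theorem QTy.wkQ_rename {a b k l : ℕ} (ρt : Fin a → Fin b) (ρq : Fin k → Fin l) (T : QTy a k) :
    T.wkQ.rename ρt (up ρq) = (T.rename ρt ρq).wkQ := by
  simp [QTy.wkQ, QTy.rename, STy.rename_rename, Qual.rename_rename, up]

theorem Qual.wkQ_rename {k l : ℕ} (ρq : Fin k → Fin l) (Q : Qual k) :
    Q.wkQ.rename (up ρq) = (Q.rename ρq).wkQ := by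
  simp [Qual.wkQ, Qual.rename_rename, up]

theorem Qual.wkQ_subst {k l : ℕ} (τq : Fin k → Qual l) (Q : Qual k) :
    Q.wkQ.subst (upQ τq) = (Q.subst τq).wkQ := by
  simp [Qual.wkQ, Qual.rename_subst, Qual.subst_rename, upQ]

theorem QTy.wkT_subst {a b k l : ℕ} (τt : Fin a → STy b l) (τq : Fin k → Qual l) (T : QTy a k) :
    T.wkT.subst (upT τt) τq = (T.subst τt τq).wkT := by
  refine QTy.ext ?_ (STy.wkT_subst _ _ _)
  simp [QTy.wkT, QTy.subst, QTy.rename, Qual.rename_id]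

theorem QTy.wkQ_subst {a b k l : ℕ} (τt : Fin a → STy b l) (τq : Fin k → Qual l) (T : QTy a k) :
    T.wkQ.subst (fun i => (τt i).wkQ) (upQ τq) = (T.subst τt τq).wkQ :=
  QTy.ext (Qual.wkQ_subst _ _) (STy.wkQ_subst _ _ _)

/-! ### Instantiating the most recent variable -/

theorem STy.wkT_inst {n k : ℕ} (S U : STy n k) :
    S.wkT.subst (Fin.cases U STy.var) Qual.var = S := by
  simp [STy.wkT, STy.subst_rename, STy.subst_var]

theorem STy.wkQ_inst {n k : ℕ} (S : STy n k) (Q : Qual k) :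
    S.wkQ.subst STy.var (Fin.cases Q Qual.var) = S := by
  simp [STy.wkQ, STy.subst_rename, STy.subst_var]

theorem Qual.wkQ_inst {k : ℕ} (R Q : Qual k) :
    R.wkQ.subst (Fin.cases Q Qual.var) = R := by
  simp [Qual.wkQ, Qual.subst_rename, Qual.subst_var]

theorem QTy.wkT_inst {n k : ℕ} (T : QTy n k) (U : STy n k) :
    T.wkT.subst (Fin.cases U STy.var) Qual.var = T := by
  refine QTy.ext ?_ (STy.wkT_inst _ _)
  simp [QTy.wkT, QTy.subst, QTy.rename, Qual.rename_id, Qual.subst_var]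

theorem QTy.wkQ_inst {n k : ℕ} (T : QTy n k) (Q : Qual k) :
    T.wkQ.subst STy.var (Fin.cases Q Qual.var) = T :=
  QTy.ext (Qual.wkQ_inst _ _) (STy.wkQ_inst _ _)

theorem QTy.instT_rename {a b k l : ℕ} (ρt : Fin a → Fin b) (ρq : Fin k → Fin l)
    (T : QTy (a + 1) k) (S : STy a k) :
    (T.instT S).rename ρt ρq = (T.rename (up ρt) ρq).instT (S.rename ρt ρq) := by
  simp only [QTy.instT, QTy.subst, QTy.rename, Qual.rename_subst, Qual.subst_rename,
    STy.rename_subst, STy.subst_rename, Qual.rename]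
  congr 2
  funext i; cases i using Fin.cases <;> rfl

theorem QTy.instQ_rename {a b k l : ℕ} (ρt : Fin a → Fin b) (ρq : Fin k → Fin l)
    (T : QTy a (k + 1)) (Q : Qual k) :
    (T.instQ Q).rename ρt ρq = (T.rename ρt (up ρq)).instQ (Q.rename ρq) := by
  simp only [QTy.instQ, QTy.subst, QTy.rename, Qual.rename_subst, Qual.subst_rename,
    STy.rename_subst, STy.subst_rename, STy.rename]
  have h : (fun i => Qual.rename ρq (Fin.cases (motive := fun _ => Qual k) Q Qual.var i)) =
      fun i => (Fin.cases (motive := fun _ => Qual l) (Q.rename ρq) Qual.var (up ρq i)) := by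
    funext i; cases i using Fin.cases <;> rfl
  rw [h]

/-- The rule for type application has an instantiated type as its result. After a substitution that
type must again be visibly an instance for the rule to apply. -/
theorem QTy.instT_subst {a b k l : ℕ} (τt : Fin a → STy b l) (τq : Fin k → Qual l)
    (T : QTy (a + 1) k) (S : STy a k) :
    (T.instT S).subst τt τq = (T.subst (upT τt) τq).instT (S.subst τt τq) := by
  simp only [QTy.instT, QTy.subst, Qual.subst_subst, STy.subst_subst, Qual.subst_var]
  congr 2
  funext i
  cases i using Fin.cases with
  | zero => rfl
  | succ i => exact (STy.wkT_inst _ _).symm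

theorem QTy.instQ_subst {a b k l : ℕ} (τt : Fin a → STy b l) (τq : Fin k → Qual l)
    (T : QTy a (k + 1)) (Q : Qual k) :
    (T.instQ Q).subst τt τq =
      (T.subst (fun i => (τt i).wkQ) (upQ τq)).instQ (Q.subst τq) := by
  simp only [QTy.instQ, QTy.subst, Qual.subst_subst, STy.subst_subst, STy.wkQ_inst]
  have h : (fun i => Qual.subst τq (Fin.cases (motive := fun _ => Qual k) Q Qual.var i)) =
      fun i => (upQ τq i).subst (Fin.cases (Q.subst τq) Qual.var) := by
    funext i
    cases i using Fin.cases with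
    | zero => rfl
    | succ i => exact (Qual.wkQ_inst _ _).symm
  rw [h]
  rfl

/-! ### Subqualification -/

section SubQual

variable {m n k m' n' k' : ℕ} {Γ : Ctx m n k} {Γ' : Ctx m' n' k'}

theorem SubQual.refl (Q : Qual k) : SubQual Γ Q Q := by
  induction Q with
  | top => exact .top
  | bot => exact .bot
  | var Y => exact .refl_var
  | meet Q R hQ hR => exact .meet_intro (.meet_elim_1 (hQ)) (.meet_elim_2 (hR))
  | join Q R hQ hR => exact .join_elim (.join_intro_1 (hQ)) (.join_intro_2 (hR))

/-- No rule but reflexivity-free introduction can act on `top` at the left, so the derivation only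
takes `R` apart, and the left side can be replaced throughout. -/
theorem SubQual.top_left {R : Qual k} (h : SubQual Γ .top R) (Q : Qual k) : SubQual Γ Q R := by
  generalize hM : Qual.top = M at h
  induction h with
  | top => exact .top
  | meet_intro _ _ h₁ h₂ => exact .meet_intro (h₁ hM) (h₂ hM)
  | join_intro_1 _ h => exact .join_intro_1 (h hM)
  | join_intro_2 _ h => exact .join_intro_2 (h hM)
  | _ => cases hM

theorem SubQual.bot_right {Q : Qual k} (h : SubQual Γ Q .bot) (R : Qual k) : SubQual Γ Q R := by
  generalize hM : Qual.bot = M at h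
  induction h with
  | bot => exact .bot
  | var _ h => exact .var (h hM)
  | meet_elim_1 _ h => exact .meet_elim_1 (h hM)
  | meet_elim_2 _ h => exact .meet_elim_2 (h hM)
  | join_elim _ _ h₁ h₂ => exact .join_elim (h₁ hM) (h₂ hM)
  | _ => cases hM

/-- Left elimination of a join is invertible: the derivation may decompose `R` first, and those
steps commute with splitting the join. -/
theorem SubQual.join_left {A B R : Qual k} (h : SubQual Γ (.join A B) R) :
    SubQual Γ A R ∧ SubQual Γ B R := by
  generalize hM : Qual.join A B = M at h
  induction h with
  | top => exact ⟨.top, .top⟩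
  | meet_intro _ _ h₁ h₂ =>
    exact ⟨.meet_intro (h₁ hM).1 (h₂ hM).1, .meet_intro (h₁ hM).2 (h₂ hM).2⟩
  | join_intro_1 _ h => exact ⟨.join_intro_1 (h hM).1, .join_intro_1 (h hM).2⟩
  | join_intro_2 _ h => exact ⟨.join_intro_2 (h hM).1, .join_intro_2 (h hM).2⟩
  | join_elim h₁ h₂ => cases hM; exact ⟨h₁, h₂⟩
  | _ => cases hM

theorem SubQual.meet_right {Q A B : Qual k} (h : SubQual Γ Q (.meet A B)) :
    SubQual Γ Q A ∧ SubQual Γ Q B := by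
  generalize hM : Qual.meet A B = M at h
  induction h with
  | bot => exact ⟨.bot, .bot⟩
  | var _ h => exact ⟨.var (h hM).1, .var (h hM).2⟩
  | meet_elim_1 _ h => exact ⟨.meet_elim_1 (h hM).1, .meet_elim_1 (h hM).2⟩
  | meet_elim_2 _ h => exact ⟨.meet_elim_2 (h hM).1, .meet_elim_2 (h hM).2⟩
  | join_elim _ _ h₁ h₂ =>
    exact ⟨.join_elim (h₁ hM).1 (h₂ hM).1, .join_elim (h₁ hM).2 (h₂ hM).2⟩
  | meet_intro h₁ h₂ => cases hM; exact ⟨h₁, h₂⟩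
  | _ => cases hM

/-- Cut elimination by induction on the middle qualifier. For a meet or join, inversion splits one
premise completely; the other is traversed until the rule that acts on the middle, where the cut
moves to a component. For a variable, the left derivation is traversed down to reflexivity. -/
theorem SubQual.trans {Q M R : Qual k} (h₁ : SubQual Γ Q M) (h₂ : SubQual Γ M R) :
    SubQual Γ Q R := by
  induction M generalizing Q R with
  | top => exact h₂.top_left Q
  | bot => exact h₁.bot_right R
  | var Y =>
    generalize hM : Qual.var Y = M at h₁
    induction h₁ with
    | bot => exact .bot
    | refl_var => cases hM; exact h₂
    | var _ h => exact .var (h hM)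
    | meet_elim_1 _ h => exact .meet_elim_1 (h hM)
    | meet_elim_2 _ h => exact .meet_elim_2 (h hM)
    | join_elim _ _ h h' => exact .join_elim (h hM) (h' hM)
    | _ => cases hM
  | meet A B ihA ihB =>
    obtain ⟨hA, hB⟩ := h₁.meet_right
    clear h₁
    generalize hM : Qual.meet A B = M at h₂
    induction h₂ with
    | top => exact .top
    | meet_elim_1 h => cases hM; exact ihA hA h
    | meet_elim_2 h => cases hM; exact ihB hB h
    | meet_intro _ _ h h' => exact .meet_intro (h hM) (h' hM)
    | join_intro_1 _ h => exact .join_intro_1 (h hM)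
    | join_intro_2 _ h => exact .join_intro_2 (h hM)
    | _ => cases hM
  | join A B ihA ihB =>
    obtain ⟨hA, hB⟩ := h₂.join_left
    clear h₂
    generalize hM : Qual.join A B = M at h₁
    induction h₁ with
    | bot => exact .bot
    | var _ h => exact .var (h hM)
    | meet_elim_1 _ h => exact .meet_elim_1 (h hM)
    | meet_elim_2 _ h => exact .meet_elim_2 (h hM)
    | join_elim _ _ h h' => exact .join_elim (h hM) (h' hM)
    | join_intro_1 h => cases hM; exact ihA h hA
    | join_intro_2 h => cases hM; exact ihB h hB
    | _ => cases hM

theorem SubQual.subst {τ : Fin k → Qual k'}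
    (hτ : ∀ Y, SubQual Γ' (τ Y) ((Γ.boundQ Y).subst τ)) {Q R : Qual k} (h : SubQual Γ Q R) :
    SubQual Γ' (Q.subst τ) (R.subst τ) := by
  induction h with
  | top => exact .top
  | bot => exact .bot
  | refl_var => exact .refl _
  | var _ h => exact (hτ _).trans h
  | meet_elim_1 _ h => exact .meet_elim_1 h
  | meet_elim_2 _ h => exact .meet_elim_2 h
  | meet_intro _ _ h h' => exact .meet_intro h h'
  | join_intro_1 _ h => exact .join_intro_1 h
  | join_intro_2 _ h => exact .join_intro_2 h
  | join_elim _ _ h h' => exact .join_elim h h'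

theorem SubQual.rename {ρ : Fin k → Fin k'}
    (hρ : ∀ Y, Γ'.boundQ (ρ Y) = (Γ.boundQ Y).rename ρ) {Q R : Qual k} (h : SubQual Γ Q R) :
    SubQual Γ' (Q.rename ρ) (R.rename ρ) := by
  induction h with
  | top => exact .top
  | bot => exact .bot
  | refl_var => exact .refl _
  | var _ h => exact .var (by rw [hρ]; exact h)
  | meet_elim_1 _ h => exact .meet_elim_1 h
  | meet_elim_2 _ h => exact .meet_elim_2 h
  | meet_intro _ _ h h' => exact .meet_intro h h'
  | join_intro_1 _ h => exact .join_intro_1 h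
  | join_intro_2 _ h => exact .join_intro_2 h
  | join_elim _ _ h h' => exact .join_elim h h'

theorem SubQual.narrow {Δ : Ctx m' n' k}
    (hΔ : ∀ Y, SubQual Δ (Δ.boundQ Y) (Γ.boundQ Y)) {Q R : Qual k} (h : SubQual Γ Q R) :
    SubQual Δ Q R := by
  -- Narrowing is the identity substitution between contexts with different bounds.
  have := h.subst (Γ' := Δ) (τ := Qual.var)
    (fun Y => by rw [Qual.subst_var]; exact .var (hΔ Y))
  rwa [Qual.subst_var, Qual.subst_var] at this

theorem SubQual.wkQ {B Q R : Qual k} (h : SubQual Γ Q R) :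
    SubQual (Γ.consQ B) Q.wkQ R.wkQ :=
  h.rename fun _ => rfl

theorem SubQual.consV {Q R : Qual k} (h : SubQual Γ Q R) (T : QTy n k) :
    SubQual (Γ.consV T) Q R :=
  SubQual.narrow (Γ := Γ) (Δ := Γ.consV T) (fun _ => .refl _) h

theorem SubQual.consT {Q R : Qual k} (h : SubQual Γ Q R) (B : STy n k) :
    SubQual (Γ.consT B) Q R :=
  SubQual.narrow (Γ := Γ) (Δ := Γ.consT B) (fun _ => .refl _) h

end SubQual

/-! ### Subtyping -/

theorem SubS.refl {m n k : ℕ} (Γ : Ctx m n k) (S : STy n k) : SubS Γ S S := by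
  induction S generalizing m with
  | top => exact .top
  | var X => exact .refl_var
  | arr Q₁ S₁ Q₂ S₂ h₁ h₂ => exact .arr (.refl _) (h₁ _) (.refl _) (h₂ _)
  | all B Q S hB hS => exact .all (hB _) (.refl _) (hS _)
  | qall B Q S hS => exact .qall (.refl _) (.refl _) (hS _)
  | box Q S hS => exact .box (.refl _) (.refl _) (hS _) (hS _)

/-- `ρt` and `ρq` map the variables of `Γ` to variables of `Γ'` with the renamed bounds. -/
structure BoundRename {m n k m' n' k' : ℕ} (Γ : Ctx m n k) (Γ' : Ctx m' n' k')
    (ρt : Fin n → Fin n') (ρq : Fin k → Fin k') : Prop where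
  ty : ∀ X, Γ'.boundT (ρt X) = (Γ.boundT X).rename ρt ρq
  qual : ∀ Y, Γ'.boundQ (ρq Y) = (Γ.boundQ Y).rename ρq

section BoundRename

variable {m n k m' n' k' : ℕ} {Γ : Ctx m n k} {Γ' : Ctx m' n' k'}
  {ρt : Fin n → Fin n'} {ρq : Fin k → Fin k'}

theorem BoundRename.consV (h : BoundRename Γ Γ' ρt ρq) (T : QTy n k) (T' : QTy n' k') :
    BoundRename (Γ.consV T) (Γ'.consV T') ρt ρq :=
  ⟨h.ty, h.qual⟩

theorem BoundRename.consT (h : BoundRename Γ Γ' ρt ρq) (B : STy n k) :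
    BoundRename (Γ.consT B) (Γ'.consT (B.rename ρt ρq)) (up ρt) ρq := by
  refine ⟨fun X => ?_, h.qual⟩
  cases X using Fin.cases with
  | zero => exact (STy.wkT_rename _ _ _).symm
  | succ X => exact (congrArg STy.wkT (h.ty X)).trans (STy.wkT_rename _ _ _).symm

theorem BoundRename.consQ (h : BoundRename Γ Γ' ρt ρq) (B : Qual k) :
    BoundRename (Γ.consQ B) (Γ'.consQ (B.rename ρq)) ρt (up ρq) := by
  refine ⟨fun X => (congrArg STy.wkQ (h.ty X)).trans (STy.wkQ_rename _ _ _).symm, fun Y => ?_⟩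
  cases Y using Fin.cases with
  | zero => exact (Qual.wkQ_rename _ _).symm
  | succ Y => exact (congrArg Qual.wkQ (h.qual Y)).trans (Qual.wkQ_rename _ _).symm

theorem BoundRename.wkV (Γ : Ctx m n k) (T : QTy n k) : BoundRename Γ (Γ.consV T) id id :=
  ⟨fun _ => (STy.rename_id _).symm, fun _ => (Qual.rename_id _).symm⟩

theorem BoundRename.wkT (Γ : Ctx m n k) (B : STy n k) :
    BoundRename Γ (Γ.consT B) Fin.succ id :=
  ⟨fun _ => rfl, fun _ => (Qual.rename_id _).symm⟩

theorem BoundRename.wkQ (Γ : Ctx m n k) (B : Qual k) :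
    BoundRename Γ (Γ.consQ B) id Fin.succ :=
  ⟨fun _ => rfl, fun _ => rfl⟩

end BoundRename

/-- Variables go to variables with matching bounds, so the variable rule is preserved without
transitivity. The resulting weakening lemmas are therefore available inside the proof of
transitivity. -/
theorem SubS.rename {m n k m' n' k' : ℕ} {Γ : Ctx m n k} {Γ' : Ctx m' n' k'}
    {ρt : Fin n → Fin n'} {ρq : Fin k → Fin k'} (hρ : BoundRename Γ Γ' ρt ρq) {S U : STy n k}
    (h : SubS Γ S U) : SubS Γ' (S.rename ρt ρq) (U.rename ρt ρq) := by
  induction h generalizing m' n' k' with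
  | top => exact .top
  | refl_var => exact .refl_var
  | var _ ih => exact .var (by rw [hρ.ty]; exact ih hρ)
  | arr h₁ _ h₂ _ ih₁ ih₂ =>
    exact .arr (h₁.rename hρ.qual) (ih₁ hρ) (h₂.rename hρ.qual) (ih₂ hρ)
  | all _ h₂ _ ih₁ ih₂ =>
    exact .all (ih₁ hρ) (h₂.rename (hρ.consT _).qual) (ih₂ (hρ.consT _))
  | qall h₁ h₂ _ ih =>
    exact .qall (h₁.rename hρ.qual) (h₂.rename (hρ.consQ _).qual) (ih (hρ.consQ _))
  | box h₁ h₂ _ _ ih₁ ih₂ =>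
    exact .box (h₁.rename hρ.qual) (h₂.rename hρ.qual) (ih₁ hρ) (ih₂ hρ)

theorem SubS.consV {m n k : ℕ} {Γ : Ctx m n k} {S U : STy n k} (h : SubS Γ S U)
    (T : QTy n k) : SubS (Γ.consV T) S U := by
  simpa only [STy.rename_id] using h.rename (.wkV Γ T)

theorem SubS.wkT {m n k : ℕ} {Γ : Ctx m n k} {B S U : STy n k} (h : SubS Γ S U) :
    SubS (Γ.consT B) S.wkT U.wkT :=
  h.rename (.wkT Γ B)

theorem SubS.wkQ {m n k : ℕ} {Γ : Ctx m n k} {B : Qual k} {S U : STy n k} (h : SubS Γ S U) :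
    SubS (Γ.consQ B) S.wkQ U.wkQ :=
  h.rename (.wkQ Γ B)

/-! ### Transitivity and narrowing of subtyping -/

/-- The number of constructors of a simple type, not counting qualifiers. -/
def STy.size {n k : ℕ} : STy n k → ℕ
  | .top => 1
  | .var _ => 1
  | .arr _ S₁ _ S₂ => S₁.size + S₂.size + 1
  | .all B _ S => B.size + S.size + 1
  | .qall _ _ S => S.size + 1
  | .box _ S => S.size + 1

/-- A bound read from a context is a weakening of a component of the middle type and not itself a
component. An induction on size is insensitive to this, unlike a structural one. -/
theorem STy.size_rename {n k n' k' : ℕ} (ρt : Fin n → Fin n') (ρq : Fin k → Fin k')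
    (S : STy n k) : (S.rename ρt ρq).size = S.size := by
  induction S generalizing n' k' <;> simp_all [STy.rename, STy.size]

/-- Subtyping is transitive through every middle type of size less than `N`. -/
def TransBelow (N : ℕ) : Prop :=
  ∀ {m n k : ℕ} {Γ : Ctx m n k} {S M U : STy n k}, M.size < N →
    SubS Γ S M → SubS Γ M U → SubS Γ S U

/-- Narrowing, for type variable bounds through which subtyping is known to be transitive. -/
theorem SubS.narrow_of_transBelow {N : ℕ} (hN : TransBelow N) {m m' n k : ℕ} {Γ : Ctx m n k}
    {Γ' : Ctx m' n k}
    (ht : ∀ X, Γ'.boundT X = Γ.boundT X ∨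
      (Γ.boundT X).size < N ∧ SubS Γ' (Γ'.boundT X) (Γ.boundT X))
    (hq : ∀ Y, SubQual Γ' (Γ'.boundQ Y) (Γ.boundQ Y)) {S U : STy n k} (h : SubS Γ S U) :
    SubS Γ' S U := by
  induction h generalizing m' with
  | top => exact .top
  | refl_var => exact .refl_var
  | @var _ _ Γ X _ _ ih =>
    refine .var ?_
    rcases ht X with h | ⟨h, h'⟩
    · rw [h]; exact ih ht hq
    -- The new bound lies below the old one, and the old one lies below the target: a cut through
    -- the old bound, whose size is below `N`.
    · exact hN h h' (ih ht hq)
  | arr h₁ _ h₂ _ ih₁ ih₂ => exact .arr (h₁.narrow hq) (ih₁ ht hq) (h₂.narrow hq) (ih₂ ht hq)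
  | @all _ _ Γ _ B _ _ _ _ _ h₂ _ ih₁ ih₂ =>
    have hq' : ∀ Y, SubQual (Γ'.consT B) ((Γ'.consT B).boundQ Y) ((Γ.consT B).boundQ Y) :=
      fun Y => (hq Y).consT B
    refine .all (ih₁ ht hq) (h₂.narrow hq') (ih₂ (fun X => ?_) hq')
    cases X using Fin.cases with
    | zero => exact .inl rfl
    | succ X =>
      rcases ht X with h | ⟨h, h'⟩
      · exact .inl (congrArg STy.wkT h)
      · exact .inr ⟨by rwa [← STy.size_rename Fin.succ id] at h, h'.wkT⟩
  | @qall _ _ Γ _ B _ _ _ _ h₁ h₂ _ ih =>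
    have hq' : ∀ Y, SubQual (Γ'.consQ B) ((Γ'.consQ B).boundQ Y) ((Γ.consQ B).boundQ Y) := by
      intro Y
      cases Y using Fin.cases with
      | zero => exact .refl _
      | succ Y => exact (hq Y).wkQ
    refine .qall (h₁.narrow hq) (h₂.narrow hq') (ih (fun X => ?_) hq')
    rcases ht X with h | ⟨h, h'⟩
    · exact .inl (congrArg STy.wkQ h)
    · exact .inr ⟨by rwa [← STy.size_rename id Fin.succ] at h, h'.wkQ⟩
  | box h₁ h₂ _ _ ih₁ ih₂ => exact .box (h₁.narrow hq) (h₂.narrow hq) (ih₁ ht hq) (ih₂ ht hq)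

/-- Induction on the size bound, then on the first derivation, since its variable rule leaves the
middle type unchanged. Matching constructors reduce to cuts at strictly smaller components; for
quantifiers the bodies are compared under different bounds, so the first comparison is narrowed to
the smaller bound before the cut. -/
theorem transBelow (N : ℕ) : TransBelow N := by
  induction N with
  | zero => exact fun h => absurd h (Nat.not_lt_zero _)
  | succ N ih =>
    intro m n k Γ S M U hM h₁ h₂
    induction h₁ with
    | top => cases h₂; exact .top
    | refl_var => exact h₂
    | var _ h => exact .var (h hM h₂)
    | arr hQ₁ hS₁ hQ₂ hS₂ =>
      simp only [STy.size] at hM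
      cases h₂ with
      | top => exact .top
      | arr kQ₁ kS₁ kQ₂ kS₂ =>
        exact .arr (kQ₁.trans hQ₁) (ih (by omega) kS₁ hS₁) (hQ₂.trans kQ₂) (ih (by omega) hS₂ kS₂)
    | @all _ _ Γ _ B _ _ _ _ hB hQ hS =>
      simp only [STy.size] at hM
      cases h₂ with
      | top => exact .top
      | @all _ _ _ _ B' _ _ _ _ kB kQ kS =>
        have hq : ∀ Y, SubQual (Γ.consT B') ((Γ.consT B').boundQ Y) ((Γ.consT B).boundQ Y) :=
          fun _ => .refl _
        refine .all (ih (by omega) kB hB) ((hQ.narrow hq).trans kQ) (ih (by omega) ?_ kS)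
        refine SubS.narrow_of_transBelow (Γ := Γ.consT B) ih (fun X => ?_) hq hS
        cases X using Fin.cases with
        | zero =>
          -- The narrowed bound `B` is a proper component of the middle quantifier, so the induction
          -- hypothesis already covers cuts through it.
          exact .inr ⟨lt_of_eq_of_lt (STy.size_rename _ _ _) (by omega), kB.wkT⟩
        | succ X => exact .inl rfl
    | @qall _ _ Γ _ B _ _ _ _ hB hQ hS =>
      simp only [STy.size] at hM
      cases h₂ with
      | top => exact .top
      | @qall _ _ _ _ B' _ _ _ _ kB kQ kS =>
        have hq : ∀ Y, SubQual (Γ.consQ B') ((Γ.consQ B').boundQ Y) ((Γ.consQ B).boundQ Y) := by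
          intro Y
          cases Y using Fin.cases with
          | zero => exact kB.wkQ
          | succ Y => exact .refl _
        exact .qall (kB.trans hB) ((hQ.narrow hq).trans kQ)
          (ih (by omega) (SubS.narrow_of_transBelow (Γ := Γ.consQ B) (Γ' := Γ.consQ B') ih
            (fun _ => .inl rfl) hq hS) kS)
    | box hQ hQ' hS hS' =>
      simp only [STy.size] at hM
      cases h₂ with
      | top => exact .top
      | box kQ kQ' kS kS' =>
        exact .box (hQ.trans kQ) (kQ'.trans hQ') (ih (by omega) hS kS) (ih (by omega) kS' hS')

theorem SubS.trans {m n k : ℕ} {Γ : Ctx m n k} {S M U : STy n k} (h₁ : SubS Γ S M)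
    (h₂ : SubS Γ M U) : SubS Γ S U :=
  transBelow _ (Nat.lt_succ_self _) h₁ h₂

theorem SubT.refl {m n k : ℕ} (Γ : Ctx m n k) (T : QTy n k) : SubT Γ T T :=
  ⟨.refl _, .refl _ _⟩

theorem SubT.trans {m n k : ℕ} {Γ : Ctx m n k} {T M U : QTy n k} (h₁ : SubT Γ T M)
    (h₂ : SubT Γ M U) : SubT Γ T U :=
  ⟨h₁.1.trans h₂.1, h₁.2.trans h₂.2⟩

/-! ### Well-typed substitutions of types and qualifiers -/

/-- `τt` and `τq` map the variables of `Γ` to types and qualifiers over `Γ'` that respect their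
bounds. -/
structure BoundSubst {m n k m' n' k' : ℕ} (Γ : Ctx m n k) (Γ' : Ctx m' n' k')
    (τt : Fin n → STy n' k') (τq : Fin k → Qual k') : Prop where
  ty : ∀ X, SubS Γ' (τt X) ((Γ.boundT X).subst τt τq)
  qual : ∀ Y, SubQual Γ' (τq Y) ((Γ.boundQ Y).subst τq)

section BoundSubst

variable {m n k m' n' k' : ℕ} {Γ : Ctx m n k} {Γ' : Ctx m' n' k'}
  {τt : Fin n → STy n' k'} {τq : Fin k → Qual k'}

theorem BoundSubst.consV (h : BoundSubst Γ Γ' τt τq) (T : QTy n k) (T' : QTy n' k') :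
    BoundSubst (Γ.consV T) (Γ'.consV T') τt τq :=
  ⟨fun X => (h.ty X).consV T', fun Y => (h.qual Y).consV T'⟩

theorem BoundSubst.consT (h : BoundSubst Γ Γ' τt τq) (B : STy n k) :
    BoundSubst (Γ.consT B) (Γ'.consT (B.subst τt τq)) (upT τt) τq := by
  refine ⟨fun X => ?_, fun Y => (h.qual Y).consT _⟩
  cases X using Fin.cases with
  | zero =>
    refine .var ?_
    rw [show (Γ.consT B).boundT 0 = B.wkT from rfl, STy.wkT_subst]
    exact .refl _ _
  | succ X =>
    rw [show (Γ.consT B).boundT X.succ = (Γ.boundT X).wkT from rfl, STy.wkT_subst]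
    exact (h.ty X).wkT

theorem BoundSubst.consQ (h : BoundSubst Γ Γ' τt τq) (B : Qual k) :
    BoundSubst (Γ.consQ B) (Γ'.consQ (B.subst τq)) (fun i => (τt i).wkQ) (upQ τq) := by
  refine ⟨fun X => ?_, fun Y => ?_⟩
  · rw [show (Γ.consQ B).boundT X = (Γ.boundT X).wkQ from rfl, STy.wkQ_subst]
    exact (h.ty X).wkQ
  · cases Y using Fin.cases with
    | zero =>
      refine .var ?_
      rw [show (Γ.consQ B).boundQ 0 = B.wkQ from rfl, Qual.wkQ_subst]
      exact .refl _
    | succ Y =>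
      rw [show (Γ.consQ B).boundQ Y.succ = (Γ.boundQ Y).wkQ from rfl, Qual.wkQ_subst]
      exact (h.qual Y).wkQ

end BoundSubst

/-- At a variable, its image is below the substituted bound, which is below the target by induction;
transitivity joins the two. -/
theorem SubS.subst {m n k m' n' k' : ℕ} {Γ : Ctx m n k} {Γ' : Ctx m' n' k'}
    {τt : Fin n → STy n' k'} {τq : Fin k → Qual k'} (hτ : BoundSubst Γ Γ' τt τq)
    {S U : STy n k} (h : SubS Γ S U) : SubS Γ' (S.subst τt τq) (U.subst τt τq) := by
  induction h generalizing m' n' k' with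
  | top => exact .top
  | refl_var => exact .refl _ _
  | var _ ih => exact (hτ.ty _).trans (ih hτ)
  | arr h₁ _ h₂ _ ih₁ ih₂ =>
    exact .arr (h₁.subst hτ.qual) (ih₁ hτ) (h₂.subst hτ.qual) (ih₂ hτ)
  | all _ h₂ _ ih₁ ih₂ =>
    exact .all (ih₁ hτ) (h₂.subst (hτ.consT _).qual) (ih₂ (hτ.consT _))
  | qall h₁ h₂ _ ih =>
    exact .qall (h₁.subst hτ.qual) (h₂.subst (hτ.consQ _).qual) (ih (hτ.consQ _))
  | box h₁ h₂ _ _ ih₁ ih₂ =>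
    exact .box (h₁.subst hτ.qual) (h₂.subst hτ.qual) (ih₁ hτ) (ih₂ hτ)

theorem SubT.subst {m n k m' n' k' : ℕ} {Γ : Ctx m n k} {Γ' : Ctx m' n' k'}
    {τt : Fin n → STy n' k'} {τq : Fin k → Qual k'} (hτ : BoundSubst Γ Γ' τt τq)
    {T U : QTy n k} (h : SubT Γ T U) : SubT Γ' (T.subst τt τq) (U.subst τt τq) :=
  ⟨h.1.subst hτ.qual, h.2.subst hτ⟩

theorem BoundSubst.refl {m n k : ℕ} (Γ : Ctx m n k) : BoundSubst Γ Γ STy.var Qual.var :=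
  ⟨fun X => .var (by rw [STy.subst_var]; exact .refl _ _),
    fun Y => .var (by rw [Qual.subst_var]; exact .refl _)⟩

theorem BoundSubst.instV {m n k : ℕ} (Γ : Ctx m n k) (T : QTy n k) :
    BoundSubst (Γ.consV T) Γ STy.var Qual.var :=
  ⟨(BoundSubst.refl Γ).ty, (BoundSubst.refl Γ).qual⟩

theorem BoundSubst.instT {m n k : ℕ} {Γ : Ctx m n k} {B S : STy n k} (h : SubS Γ S B) :
    BoundSubst (Γ.consT B) Γ (Fin.cases S STy.var) Qual.var := by
  refine ⟨fun X => ?_, (BoundSubst.refl Γ).qual⟩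
  cases X using Fin.cases with
  | zero =>
    rw [show (Γ.consT B).boundT 0 = B.wkT from rfl, STy.wkT_inst]
    exact h
  | succ X =>
    rw [show (Γ.consT B).boundT X.succ = (Γ.boundT X).wkT from rfl, STy.wkT_inst]
    exact .var (.refl _ _)

theorem BoundSubst.instQ {m n k : ℕ} {Γ : Ctx m n k} {B R : Qual k} (h : SubQual Γ R B) :
    BoundSubst (Γ.consQ B) Γ STy.var (Fin.cases R Qual.var) := by
  refine ⟨fun X => ?_, fun Y => ?_⟩
  · rw [show (Γ.consQ B).boundT X = (Γ.boundT X).wkQ from rfl, STy.wkQ_inst]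
    exact .var (.refl _ _)
  · cases Y using Fin.cases with
    | zero =>
      rw [show (Γ.consQ B).boundQ 0 = B.wkQ from rfl, Qual.wkQ_inst]
      exact h
    | succ Y =>
      rw [show (Γ.consQ B).boundQ Y.succ = (Γ.boundQ Y).wkQ from rfl, Qual.wkQ_inst]
      exact .var (.refl _)

/-! ### Renaming of typing derivations -/

/-- `ρ`, `ρt` and `ρq` map the variables of `Γ` to variables of `Γ'` with the renamed types and
bounds, and the store environment `E'` contains the renamed types of `E`. -/
structure CtxRename {m n k m' n' k' : ℕ} (Γ : Ctx m n k) (E : StoreEnv n k) (Γ' : Ctx m' n' k')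
    (E' : StoreEnv n' k') (ρ : Fin m → Fin m') (ρt : Fin n → Fin n') (ρq : Fin k → Fin k') :
    Prop extends BoundRename Γ Γ' ρt ρq where
  var : ∀ x, Γ'.typeOf (ρ x) = (Γ.typeOf x).rename ρt ρq
  store : ∀ l T, E l = some T → E' l = some (T.rename ρt ρq)

theorem StoreEnv.wkT_eq_some {n k : ℕ} {E : StoreEnv n k} {l : ℕ} {T : QTy (n + 1) k} :
    E.wkT l = some T ↔ ∃ U, E l = some U ∧ U.wkT = T :=
  Option.map_eq_some_iff

theorem StoreEnv.wkQ_eq_some {n k : ℕ} {E : StoreEnv n k} {l : ℕ} {T : QTy n (k + 1)} :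
    E.wkQ l = some T ↔ ∃ U, E l = some U ∧ U.wkQ = T :=
  Option.map_eq_some_iff

section CtxRename

variable {m n k m' n' k' : ℕ} {Γ : Ctx m n k} {Γ' : Ctx m' n' k'} {E : StoreEnv n k}
  {E' : StoreEnv n' k'} {ρ : Fin m → Fin m'} {ρt : Fin n → Fin n'} {ρq : Fin k → Fin k'}

theorem CtxRename.consV (h : CtxRename Γ E Γ' E' ρ ρt ρq) (T : QTy n k) :
    CtxRename (Γ.consV T) E (Γ'.consV (T.rename ρt ρq)) E' (up ρ) ρt ρq := by
  refine ⟨h.toBoundRename.consV _ _, fun x => ?_, h.store⟩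
  cases x using Fin.cases with
  | zero => rfl
  | succ x => exact h.var x

theorem CtxRename.consT (h : CtxRename Γ E Γ' E' ρ ρt ρq) (B : STy n k) :
    CtxRename (Γ.consT B) E.wkT (Γ'.consT (B.rename ρt ρq)) E'.wkT ρ (up ρt) ρq := by
  refine ⟨h.toBoundRename.consT _,
    fun x => (congrArg QTy.wkT (h.var x)).trans (QTy.wkT_rename _ _ _).symm, fun l T hT => ?_⟩
  obtain ⟨U, hU, rfl⟩ := StoreEnv.wkT_eq_some.1 hT
  exact StoreEnv.wkT_eq_some.2 ⟨_, h.store l U hU, (QTy.wkT_rename _ _ _).symm⟩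

theorem CtxRename.consQ (h : CtxRename Γ E Γ' E' ρ ρt ρq) (B : Qual k) :
    CtxRename (Γ.consQ B) E.wkQ (Γ'.consQ (B.rename ρq)) E'.wkQ ρ ρt (up ρq) := by
  refine ⟨h.toBoundRename.consQ _,
    fun x => (congrArg QTy.wkQ (h.var x)).trans (QTy.wkQ_rename _ _ _).symm, fun l T hT => ?_⟩
  obtain ⟨U, hU, rfl⟩ := StoreEnv.wkQ_eq_some.1 hT
  exact StoreEnv.wkQ_eq_some.2 ⟨_, h.store l U hU, (QTy.wkQ_rename _ _ _).symm⟩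

end CtxRename

/-- This provides weakening in all three sorts of variables, which `HasType.subst` needs to carry
the substituted terms under binders. -/
theorem HasType.rename {m n k m' n' k' : ℕ} {Γ : Ctx m n k} {Γ' : Ctx m' n' k'}
    {E : StoreEnv n k} {E' : StoreEnv n' k'} {ρ : Fin m → Fin m'} {ρt : Fin n → Fin n'}
    {ρq : Fin k → Fin k'} (hρ : CtxRename Γ E Γ' E' ρ ρt ρq) {t : Tm m n k} {T : QTy n k}
    (h : HasType Γ E t T) : HasType Γ' E' (t.rename ρ ρt ρq) (T.rename ρt ρq) := by
  induction h generalizing m' n' k' with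
  | var => rw [← hρ.var]; exact .var
  | abs _ ih => exact .abs (ih (hρ.consV _))
  | t_abs _ ih => exact .t_abs (T := QTy.rename _ _ _) (ih (hρ.consT _))
  | q_abs _ ih => exact .q_abs (T := QTy.rename _ _ _) (ih (hρ.consQ _))
  | app _ _ ih₁ ih₂ => exact .app (T := QTy.rename _ _ _) (U := QTy.rename _ _ _) (ih₁ hρ) (ih₂ hρ)
  | t_app _ h ih =>
    rw [QTy.instT_rename]
    exact .t_app (T := QTy.rename _ _ _) (ih hρ) (h.rename hρ.toBoundRename)
  | q_app _ h ih =>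
    rw [QTy.instQ_rename]
    exact .q_app (T := QTy.rename _ _ _) (ih hρ) (h.rename hρ.qual)
  | sub _ h ih => exact .sub (ih hρ) ⟨h.1.rename hρ.qual, h.2.rename hρ.toBoundRename⟩
  | typ_assert _ h ih => exact .typ_assert (ih hρ) (h.rename hρ.qual)
  | typ_upqual _ h ih => exact .typ_upqual (ih hρ) (h.rename hρ.qual)
  | ref_intro _ ih => exact .ref_intro (T := QTy.rename _ _ _) (ih hρ)
  | loc h => exact .loc (T := QTy.rename _ _ _) (hρ.store _ _ h)
  | ref_elim _ ih => exact .ref_elim (ih hρ)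
  | ref_update _ _ ih₁ ih₂ => exact .ref_update (T := QTy.rename _ _ _) (ih₁ hρ) (ih₂ hρ)

section Weakening

variable {m n k : ℕ} {Γ : Ctx m n k} {E E' : StoreEnv n k} {t : Tm m n k} {T : QTy n k}

theorem HasType.wkV (h : HasType Γ E t T) (U : QTy n k) : HasType (Γ.consV U) E t.wkV T := by
  have := h.rename (Γ' := Γ.consV U) (E' := E) (ρ := Fin.succ) (ρt := id) (ρq := id)
    ⟨.wkV Γ U, fun _ => (QTy.rename_id _).symm, fun _ T h => by rwa [QTy.rename_id]⟩
  rwa [QTy.rename_id] at this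

theorem HasType.wkT (h : HasType Γ E t T) (B : STy n k) :
    HasType (Γ.consT B) E.wkT t.wkT T.wkT :=
  h.rename ⟨.wkT Γ B, fun _ => rfl, fun _ T h => StoreEnv.wkT_eq_some.2 ⟨T, h, rfl⟩⟩

theorem HasType.wkQ (h : HasType Γ E t T) (B : Qual k) :
    HasType (Γ.consQ B) E.wkQ t.wkQ T.wkQ :=
  h.rename ⟨.wkQ Γ B, fun _ => rfl, fun _ T h => StoreEnv.wkQ_eq_some.2 ⟨T, h, rfl⟩⟩

theorem StoreEnv.Extends.wkT (h : E'.Extends E) : E'.wkT.Extends E.wkT := fun l T hT => by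
  obtain ⟨U, hU, rfl⟩ := StoreEnv.wkT_eq_some.1 hT
  exact StoreEnv.wkT_eq_some.2 ⟨U, h l U hU, rfl⟩

theorem StoreEnv.Extends.wkQ (h : E'.Extends E) : E'.wkQ.Extends E.wkQ := fun l T hT => by
  obtain ⟨U, hU, rfl⟩ := StoreEnv.wkQ_eq_some.1 hT
  exact StoreEnv.wkQ_eq_some.2 ⟨U, h l U hU, rfl⟩

/-- Only the location rule reads the store environment, and binders merely weaken it, which
preserves extension. -/
theorem HasType.extend (h : HasType Γ E t T) (hE : E'.Extends E) : HasType Γ E' t T := by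
  induction h with
  | var => exact .var
  | abs _ ih => exact .abs (ih hE)
  | t_abs _ ih => exact .t_abs (ih hE.wkT)
  | q_abs _ ih => exact .q_abs (ih hE.wkQ)
  | app _ _ ih₁ ih₂ => exact .app (ih₁ hE) (ih₂ hE)
  | t_app _ h ih => exact .t_app (ih hE) h
  | q_app _ h ih => exact .q_app (ih hE) h
  | sub _ h ih => exact .sub (ih hE) h
  | typ_assert _ h ih => exact .typ_assert (ih hE) h
  | typ_upqual _ h ih => exact .typ_upqual (ih hE) h
  | ref_intro _ ih => exact .ref_intro (ih hE)
  | loc h => exact .loc (hE _ _ h)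
  | ref_elim _ ih => exact .ref_elim (ih hE)
  | ref_update _ _ ih₁ ih₂ => exact .ref_update (ih₁ hE) (ih₂ hE)

end Weakening

/-! ### Substitution in typing derivations -/

/-- `τ`, `τt` and `τq` map the variables of `Γ` to terms, types and qualifiers over `Γ'` that
respect their types and bounds, and `E'` contains the substituted types of `E`. -/
structure CtxSubst {m n k m' n' k' : ℕ} (Γ : Ctx m n k) (E : StoreEnv n k) (Γ' : Ctx m' n' k')
    (E' : StoreEnv n' k') (τ : Fin m → Tm m' n' k') (τt : Fin n → STy n' k')
    (τq : Fin k → Qual k') : Prop extends BoundSubst Γ Γ' τt τq where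
  var : ∀ x, HasType Γ' E' (τ x) ((Γ.typeOf x).subst τt τq)
  store : ∀ l T, E l = some T → E' l = some (T.subst τt τq)

section CtxSubst

variable {m n k m' n' k' : ℕ} {Γ : Ctx m n k} {Γ' : Ctx m' n' k'} {E : StoreEnv n k}
  {E' : StoreEnv n' k'} {τ : Fin m → Tm m' n' k'} {τt : Fin n → STy n' k'}
  {τq : Fin k → Qual k'}

theorem CtxSubst.consV (h : CtxSubst Γ E Γ' E' τ τt τq) (T : QTy n k) :
    CtxSubst (Γ.consV T) E (Γ'.consV (T.subst τt τq)) E' (upV τ) τt τq := by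
  refine ⟨h.toBoundSubst.consV _ _, fun x => ?_, h.store⟩
  cases x using Fin.cases with
  | zero => exact .var
  | succ x => exact (h.var x).wkV _

theorem CtxSubst.consT (h : CtxSubst Γ E Γ' E' τ τt τq) (B : STy n k) :
    CtxSubst (Γ.consT B) E.wkT (Γ'.consT (B.subst τt τq)) E'.wkT (fun i => (τ i).wkT)
      (upT τt) τq := by
  refine ⟨h.toBoundSubst.consT _, fun x => ?_, fun l T hT => ?_⟩
  · rw [show (Γ.consT B).typeOf x = (Γ.typeOf x).wkT from rfl, QTy.wkT_subst]
    exact (h.var x).wkT _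
  · obtain ⟨U, hU, rfl⟩ := StoreEnv.wkT_eq_some.1 hT
    exact StoreEnv.wkT_eq_some.2 ⟨_, h.store l U hU, (QTy.wkT_subst _ _ _).symm⟩

theorem CtxSubst.consQ (h : CtxSubst Γ E Γ' E' τ τt τq) (B : Qual k) :
    CtxSubst (Γ.consQ B) E.wkQ (Γ'.consQ (B.subst τq)) E'.wkQ (fun i => (τ i).wkQ)
      (fun i => (τt i).wkQ) (upQ τq) := by
  refine ⟨h.toBoundSubst.consQ _, fun x => ?_, fun l T hT => ?_⟩
  · rw [show (Γ.consQ B).typeOf x = (Γ.typeOf x).wkQ from rfl, QTy.wkQ_subst]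
    exact (h.var x).wkQ _
  · obtain ⟨U, hU, rfl⟩ := StoreEnv.wkQ_eq_some.1 hT
    exact StoreEnv.wkQ_eq_some.2 ⟨_, h.store l U hU, (QTy.wkQ_subst _ _ _).symm⟩

end CtxSubst

theorem HasType.subst {m n k m' n' k' : ℕ} {Γ : Ctx m n k} {Γ' : Ctx m' n' k'}
    {E : StoreEnv n k} {E' : StoreEnv n' k'} {τ : Fin m → Tm m' n' k'}
    {τt : Fin n → STy n' k'} {τq : Fin k → Qual k'} (hτ : CtxSubst Γ E Γ' E' τ τt τq)
    {t : Tm m n k} {T : QTy n k} (h : HasType Γ E t T) :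
    HasType Γ' E' (t.subst τ τt τq) (T.subst τt τq) := by
  induction h generalizing m' n' k' with
  | var => exact hτ.var _
  | abs _ ih => exact .abs (ih (hτ.consV _))
  | t_abs _ ih => exact .t_abs (T := QTy.subst _ _ _) (ih (hτ.consT _))
  | q_abs _ ih => exact .q_abs (T := QTy.subst _ _ _) (ih (hτ.consQ _))
  | app _ _ ih₁ ih₂ => exact .app (T := QTy.subst _ _ _) (U := QTy.subst _ _ _) (ih₁ hτ) (ih₂ hτ)
  | t_app _ h ih =>
    rw [QTy.instT_subst]
    exact .t_app (T := QTy.subst _ _ _) (ih hτ) (h.subst hτ.toBoundSubst)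
  | q_app _ h ih =>
    rw [QTy.instQ_subst]
    exact .q_app (T := QTy.subst _ _ _) (ih hτ) (h.subst hτ.qual)
  | sub _ h ih => exact .sub (ih hτ) (h.subst hτ.toBoundSubst)
  | typ_assert _ h ih => exact .typ_assert (ih hτ) (h.subst hτ.qual)
  | typ_upqual _ h ih => exact .typ_upqual (ih hτ) (h.subst hτ.qual)
  | ref_intro _ ih => exact .ref_intro (T := QTy.subst _ _ _) (ih hτ)
  | loc h => exact .loc (T := QTy.subst _ _ _) (hτ.store _ _ h)
  | ref_elim _ ih => exact .ref_elim (ih hτ)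
  | ref_update _ _ ih₁ ih₂ => exact .ref_update (T := QTy.subst _ _ _) (ih₁ hτ) (ih₂ hτ)

section Instantiation

variable {m n k : ℕ} {Γ : Ctx m n k} {E : StoreEnv n k}

theorem HasType.instV {t : Tm (m + 1) n k} {v : Tm m n k} {T U : QTy n k}
    (ht : HasType (Γ.consV T) E t U) (hv : HasType Γ E v T) : HasType Γ E (t.instV v) U := by
  have := ht.subst (Γ' := Γ) (E' := E) (τ := Fin.cases v Tm.var)
    ⟨.instV Γ T, fun x => by
      rw [QTy.subst_var]
      cases x using Fin.cases with
      | zero => exact hv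
      | succ x => exact .var, fun _ T h => by rwa [QTy.subst_var]⟩
  rwa [QTy.subst_var] at this

/-- The environment under the binder is a weakening, so it does not mention the bound variable and
instantiation gives back exactly `E`. -/
theorem HasType.instT {t : Tm m (n + 1) k} {B S : STy n k} {T : QTy (n + 1) k}
    (ht : HasType (Γ.consT B) E.wkT t T) (hS : SubS Γ S B) :
    HasType Γ E (t.instT S) (T.instT S) := by
  refine ht.subst ⟨.instT hS, fun x => ?_, fun l T hT => ?_⟩
  · rw [show (Γ.consT B).typeOf x = (Γ.typeOf x).wkT from rfl, QTy.wkT_inst]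
    exact .var
  · obtain ⟨U, hU, rfl⟩ := StoreEnv.wkT_eq_some.1 hT
    rwa [QTy.wkT_inst]

theorem HasType.instQ {t : Tm m n (k + 1)} {B R : Qual k} {T : QTy n (k + 1)}
    (ht : HasType (Γ.consQ B) E.wkQ t T) (hR : SubQual Γ R B) :
    HasType Γ E (t.instQ R) (T.instQ R) := by
  refine ht.subst ⟨.instQ hR, fun x => ?_, fun l T hT => ?_⟩
  · rw [show (Γ.consQ B).typeOf x = (Γ.typeOf x).wkQ from rfl, QTy.wkQ_inst]
    exact .var
  · obtain ⟨U, hU, rfl⟩ := StoreEnv.wkQ_eq_some.1 hT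
    rwa [QTy.wkQ_inst]

end Instantiation

/-! ### Inversion of typing -/

section Inversion

variable {m n k : ℕ} {Γ : Ctx m n k} {E : StoreEnv n k}

/-- Above the abstraction rule only subsumption can occur, and `SubT.trans` collapses the chain. The
domain is existential because abstractions carry no annotation. -/
theorem HasType.lam_inv {P : Qual k} {t : Tm (m + 1) n k} {V : QTy n k}
    (h : HasType Γ E (.lam P t) V) :
    ∃ T U, HasType (Γ.consV T) E t U ∧ SubT Γ ⟨P, .arrow T U⟩ V := by
  generalize hs : Tm.lam P t = s at h
  induction h with
  | abs h => cases hs; exact ⟨_, _, h, .refl _ _⟩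
  | sub _ h ih =>
    obtain ⟨T, U, ht, hV⟩ := ih hs
    exact ⟨T, U, ht, hV.trans h⟩
  | _ => cases hs

theorem HasType.tlam_inv {P : Qual k} {B : STy n k} {t : Tm m (n + 1) k} {V : QTy n k}
    (h : HasType Γ E (.tlam P B t) V) :
    ∃ T, HasType (Γ.consT B) E.wkT t T ∧ SubT Γ ⟨P, .allT B T⟩ V := by
  generalize hs : Tm.tlam P B t = s at h
  induction h with
  | t_abs h => cases hs; exact ⟨_, h, .refl _ _⟩
  | sub _ h ih =>
    obtain ⟨T, ht, hV⟩ := ih hs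
    exact ⟨T, ht, hV.trans h⟩
  | _ => cases hs

theorem HasType.qlam_inv {P B : Qual k} {t : Tm m n (k + 1)} {V : QTy n k}
    (h : HasType Γ E (.qlam P B t) V) :
    ∃ T, HasType (Γ.consQ B) E.wkQ t T ∧ SubT Γ ⟨P, .allQ B T⟩ V := by
  generalize hs : Tm.qlam P B t = s at h
  induction h with
  | q_abs h => cases hs; exact ⟨_, h, .refl _ _⟩
  | sub _ h ih =>
    obtain ⟨T, ht, hV⟩ := ih hs
    exact ⟨T, ht, hV.trans h⟩
  | _ => cases hs

theorem HasType.loc_inv {P : Qual k} {l : ℕ} {V : QTy n k} (h : HasType Γ E (.loc P l) V) :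
    ∃ T, E l = some T ∧ SubT Γ ⟨P, .ref T⟩ V := by
  generalize hs : Tm.loc P l = s at h
  induction h with
  | loc h => cases hs; exact ⟨_, h, .refl _ _⟩
  | sub _ h ih =>
    obtain ⟨T, ht, hV⟩ := ih hs
    exact ⟨T, ht, hV.trans h⟩
  | _ => cases hs

/-- The type of a reference determines the type of its content up to equivalence. -/
theorem HasType.loc_ref_inv {P R : Qual k} {l : ℕ} {T : QTy n k}
    (h : HasType Γ E (.loc P l) ⟨R, .ref T⟩) :
    ∃ U, E l = some U ∧ SubQual Γ P R ∧ SubT Γ U T ∧ SubT Γ T U := by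
  obtain ⟨U, hU, hP, hS⟩ := h.loc_inv
  -- Only the invariant rule relates two reference types, and it supplies both directions.
  cases hS with
  | box h₁ h₂ h₃ h₄ => exact ⟨U, hU, hP, ⟨h₁, h₃⟩, h₂, h₄⟩

/-- The tag of a value is a lower bound of the qualifier of its type, and may be replaced. -/
theorem HasType.of_hasTag {v : Tm m n k} {Q : Qual k} (hQ : HasTag v Q) {T : QTy n k}
    (h : HasType Γ E v T) :
    SubQual Γ Q T.qual ∧ ∀ P, HasType Γ E (v.retag P) ⟨P, T.ty⟩ := by
  cases hQ with
  | lam =>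
    obtain ⟨_, _, ht, hV⟩ := h.lam_inv
    exact ⟨hV.1, fun P => .sub (.abs ht) ⟨.refl P, hV.2⟩⟩
  | tlam =>
    obtain ⟨_, ht, hV⟩ := h.tlam_inv
    exact ⟨hV.1, fun P => .sub (.t_abs ht) ⟨.refl P, hV.2⟩⟩
  | qlam =>
    obtain ⟨_, ht, hV⟩ := h.qlam_inv
    exact ⟨hV.1, fun P => .sub (.q_abs ht) ⟨.refl P, hV.2⟩⟩
  | loc =>
    obtain ⟨_, ht, hV⟩ := h.loc_inv
    exact ⟨hV.1, fun P => .sub (.loc ht) ⟨.refl P, hV.2⟩⟩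

end Inversion

/-! ### Stores -/

section Stores

variable {m n k : ℕ} {Γ : Ctx m n k} {E : StoreEnv n k} {σ : Store m n k}

theorem StoreEnv.Extends.refl (E : StoreEnv n k) : E.Extends E := fun _ _ h => h

/-- The location is already in the common domain, so overwriting it leaves the domain as it is, and
the environment can stay fixed. -/
theorem StoreTyped.insert_of_some (hσ : StoreTyped Γ E σ) {l : ℕ} {v : Val m n k} {T : QTy n k}
    (hl : E l = some T) (hv : HasType Γ E v.1 T) : StoreTyped Γ E (σ.insert l v) := by
  refine ⟨fun l' => ?_, fun l' w U hw hU => ?_⟩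
  · rw [Finmap.mem_insert, ← hσ.1]
    refine ⟨.inr, ?_⟩
    rintro (rfl | h)
    · simp [hl]
    · exact h
  · by_cases hll : l' = l
    · subst hll
      rw [Finmap.lookup_insert] at hw
      cases hw
      cases hl.symm.trans hU
      exact hv
    · rw [Finmap.lookup_insert_of_ne _ hll] at hw
      exact hσ.2 l' w U hw hU

/-- Equality of the domains makes a fresh location fresh for `E` too, so updating `E` there is an
extension. The old values and the new one are then retyped by `HasType.extend`. -/
theorem StoreTyped.alloc (hσ : StoreTyped Γ E σ) {l : ℕ} (hl : l ∉ σ) {v : Val m n k}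
    {T : QTy n k} (hv : HasType Γ E v.1 T) :
    ∃ E' : StoreEnv n k, E'.Extends E ∧ StoreTyped Γ E' (σ.insert l v) ∧ E' l = some T := by
  have hE : E l = none := by
    rw [← Option.not_isSome_iff_eq_none, hσ.1]
    exact hl
  let E' : StoreEnv n k := Function.update E l (some T)
  have hl' : E' l = some T := Function.update_self ..
  have hne : ∀ l', l' ≠ l → E' l' = E l' := fun l' h => Function.update_of_ne h ..
  have hext : E'.Extends E := fun l' U hU => by
    rw [hne, hU]
    rintro rfl
    cases hE.symm.trans hU
  refine ⟨E', hext, ⟨fun l' => ?_, fun l' w U hw hU => ?_⟩, hl'⟩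
  · by_cases hll : l' = l
    · simp [hll, hl']
    · simp [Finmap.mem_insert, hll, hne l' hll, hσ.1]
  · by_cases hll : l' = l
    · subst hll
      rw [Finmap.lookup_insert] at hw
      cases hw
      cases hl'.symm.trans hU
      exact hv.extend hext
    · rw [Finmap.lookup_insert_of_ne _ hll] at hw
      rw [hne l' hll] at hU
      exact (hσ.2 l' w U hw hU).extend hext

end Stores

/-! ### Preservation -/

/-- Inducting on typing rather than on reduction isolates subsumption as one case; every other rule
fixes the head of the term and leaves only a contraction and its congruence steps. -/
theorem HasType.preservation {m n k : ℕ} {Γ : Ctx m n k} {E : StoreEnv n k} {s t : Tm m n k}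
    {σ σ' : Store m n k} {T : QTy n k} (hs : HasType Γ E s T) (hσ : StoreTyped Γ E σ)
    (hstep : Step s σ t σ') :
    ∃ E' : StoreEnv n k, E'.Extends E ∧ StoreTyped Γ E' σ' ∧ HasType Γ E' t T := by
  induction hs with
  | var => cases hstep
  | abs => cases hstep
  | t_abs => cases hstep
  | q_abs => cases hstep
  | loc => cases hstep
  | sub _ h ih =>
    obtain ⟨E', hE, hσ', ht⟩ := ih hσ hstep
    exact ⟨E', hE, hσ', .sub ht h⟩
  | app hs ht ihs iht =>
    cases hstep with
    | beta_v _ =>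
      obtain ⟨T₀, U₀, hb, -, hS⟩ := hs.lam_inv
      cases hS with
      | arr h₁ h₂ h₃ h₄ =>
        -- Contravariance brings the argument down to the domain at which the body was typed;
        -- covariance lifts the result.
        exact ⟨_, .refl _, hσ, .sub (hb.instV (.sub ht ⟨h₁, h₂⟩)) ⟨h₃, h₄⟩⟩
    | app_left h =>
      obtain ⟨E', hE, hσ', hs'⟩ := ihs hσ h
      exact ⟨E', hE, hσ', .app hs' (ht.extend hE)⟩
    | app_right _ h =>
      obtain ⟨E', hE, hσ', ht'⟩ := iht hσ h
      exact ⟨E', hE, hσ', .app (hs.extend hE) ht'⟩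
  | t_app hs hSB ih =>
    cases hstep with
    | beta_T =>
      obtain ⟨T₀, hb, -, hS⟩ := hs.tlam_inv
      cases hS with
      | all h₁ h₂ h₃ =>
        -- The body is typed under the bound written in the abstraction, but the body types are
        -- compared under the bound of the visible type. The argument `S` satisfies the second,
        -- hence by `h₁` the first, so both judgments can be instantiated.
        exact ⟨_, .refl _, hσ, .sub (hb.instT (hSB.trans h₁)) (SubT.subst (.instT hSB) ⟨h₂, h₃⟩)⟩
    | tapp_fun h =>
      obtain ⟨E', hE, hσ', hs'⟩ := ih hσ h
      exact ⟨E', hE, hσ', .t_app hs' hSB⟩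
  | q_app hs hRB ih =>
    cases hstep with
    | beta_Q =>
      obtain ⟨T₀, hb, -, hS⟩ := hs.qlam_inv
      cases hS with
      | qall h₁ h₂ h₃ =>
        exact ⟨_, .refl _, hσ, .sub (hb.instQ (hRB.trans h₁)) (SubT.subst (.instQ hRB) ⟨h₂, h₃⟩)⟩
    | qapp_fun h =>
      obtain ⟨E', hE, hσ', hs'⟩ := ih hσ h
      exact ⟨E', hE, hσ', .q_app hs' hRB⟩
  | typ_assert hs hQP ih =>
    cases hstep with
    | assert => exact ⟨_, .refl _, hσ, hs⟩
    | assert_arg h =>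
      obtain ⟨E', hE, hσ', hs'⟩ := ih hσ h
      exact ⟨E', hE, hσ', .typ_assert hs' hQP⟩
  | typ_upqual hs hQP ih =>
    cases hstep with
    | upqual _ htag => exact ⟨_, .refl _, hσ, (hs.of_hasTag htag).2 _⟩
    | upqual_arg h =>
      obtain ⟨E', hE, hσ', hs'⟩ := ih hσ h
      exact ⟨E', hE, hσ', .typ_upqual hs' hQP⟩
  | ref_intro hs ih =>
    cases hstep with
    | ref hl =>
      obtain ⟨E', hE, hσ', hl'⟩ := hσ.alloc hl hs
      exact ⟨E', hE, hσ', .loc hl'⟩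
    | box_arg h =>
      obtain ⟨E', hE, hσ', hs'⟩ := ih hσ h
      exact ⟨E', hE, hσ', .ref_intro hs'⟩
  | ref_elim hs ih =>
    cases hstep with
    | deref hl htag =>
      obtain ⟨U, hU, hP, hUT, -⟩ := hs.loc_ref_inv
      obtain ⟨hQ, hre⟩ := (hσ.2 _ _ _ hl hU).of_hasTag htag
      -- The new tag is the join of the reference tag, below the qualifier of the reference type,
      -- and the tag of the stored value, below the qualifier of the stored type and hence of the
      -- visible content type.
      exact ⟨_, .refl _, hσ, .sub (hre _)
        ⟨.join_elim (.join_intro_1 hP) (.join_intro_2 (hQ.trans hUT.1)), hUT.2⟩⟩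
    | unbox_arg h =>
      obtain ⟨E', hE, hσ', hs'⟩ := ih hσ h
      exact ⟨E', hE, hσ', .ref_elim hs'⟩
  | ref_update hs ht ihs iht =>
    cases hstep with
    | update _ hl =>
      obtain ⟨U, hU, -, hUT, hTU⟩ := hs.loc_ref_inv
      -- Both halves of invariance are used: the written value moves from the visible type to the
      -- stored one, and the old value moves back.
      exact ⟨_, .refl _, hσ.insert_of_some hU (.sub ht hTU), .sub (hσ.2 _ _ _ hl hU) hUT⟩
    | setbox_left h =>
      obtain ⟨E', hE, hσ', hs'⟩ := ihs hσ h
      exact ⟨E', hE, hσ', .ref_update hs' (ht.extend hE)⟩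
    | setbox_right _ h =>
      obtain ⟨E', hE, hσ', ht'⟩ := iht hσ h
      exact ⟨E', hE, hσ', .ref_update (hs.extend hE) ht'⟩

end FM

theorem mainTheorem5 {m n k : ℕ} (Γ : FM.Ctx m n k) (E : FM.StoreEnv n k)
    (s t : FM.Tm m n k) (σ σ' : FM.Store m n k) (T : FM.QTy n k)
    (hstep : FM.Step s σ t σ')
    (hσ : FM.StoreTyped Γ E σ)
    (hs : FM.HasType Γ E s T) :
    ∃ E' : FM.StoreEnv n k, E'.Extends E ∧ FM.StoreTyped Γ E' σ' ∧ FM.HasType Γ E' t T := by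
  exact hs.preservation hσ hstep
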